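/- Let $\Omega\subset\mathbb R^n$ be a nonempty bounded connected open set with $C^1$ boundary $\Gamma=\partial\Omega$ and outer unit normal $\nu$. Let $H\in C(\overline\Omega\times\mathbb R^n)$, $\gamma\in C(\Gamma,\mathbb R^n)$ and $g\in C(\Gamma)$, and assume that for every $x\in\overline\Omega$ the function $H(x,\cdot)$ is convex and $H(x,p)\to\infty$ as $|p|\to\infty$, and that $\nu(x)\cdot\gamma(x)>0$ for every $x\in\Gamma$. For $a\in\mathbb R$ consider the problem $$H(x,Du)=a\ \text{ in }\Omega,\qquad D_\gamma u:=\gamma\cdot Du=g\ \text{ on }\Gamma. \tag{P$_a$}$$ A function $u:\overline\Omega\to\mathbb R$ is a *subsolution* (resp. *supersolution*) of (P$_a$) if it is bounded above (resp. below) and, whenever $\phi\in C^1(\overline\Omega)$ and $u^*-\phi$ attains its maximum (resp. $u_*-\phi$ attains its minimum) over $\overline\Omega$ at $x\in\overline\Omega$, one has $H(x,D\phi(x))\le a$ (resp. $\ge a$) if $x\in\Omega$, and $H(x,D\phi(x))\le a$ or $D_\gamma\phi(x)\le g(x)$ (resp. $H(x,D\phi(x))\ge a$ or $D_\gamma\phi(x)\ge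 g(x)$) if $x\in\Gamma$; here $u^*$ and $u_*$ are the upper and lower semicontinuous envelopes of $u$ on $\overline\Omega$. A *solution* is a function that is both a subsolution and a supersolution. Assume that the critical value is zero: $$\inf\{a\in\mathbb R : (\mathrm P_a)\text{ has a subsolution}\}=0 .$$ For $x,y\in\overline\Omega$ put $$d(x,y)=\sup\{w(x)-w(y) : w\in \mathrm{USC}(\overline\Omega)\text{ is a subsolution of }(\mathrm P_0)\},$$ and let the Aubry–Mather set be $$\mathcal A=\{y\in\overline\Omega : d(\cdot,y)\text{ is a solution of }(\mathrm P_0)\}.$$ **Theorem.** If $u\in\mathrm{USC}(\overline\Omega)$ is a subsolution and $v\in\mathrm{LSC}(\overline\Omega)$ is a supersolution of (P$_0$), and $u\le v$ on $\mathcal A$, then $u\le v$ on $\overline\Omega$. Consequently $\mathcal A$ is a uniqueness set: if $u,v\in C(\overline\Omega)$ are solutions of (P$_0$) and $u=v$ on $\mathcal A$, then $u=v$ on $\overline\Omega$. -/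

import Mathlib

open Set Filter Topology

/-- `ρ` is a `C¹` local defining function of `Ω` near `z`: `Dρ(z) ≠ 0` and, near `z`,
the set `Ω` is `{ρ < 0}`. -/
def IsLocalDefiningFunction {n : ℕ} (Ω : Set (EuclideanSpace ℝ (Fin n)))
    (z : EuclideanSpace ℝ (Fin n)) (ρ : EuclideanSpace ℝ (Fin n) → ℝ) : Prop :=
  ContDiff ℝ 1 ρ ∧ gradient ρ z ≠ 0 ∧ ∀ᶠ x in 𝓝 z, (x ∈ Ω ↔ ρ x < 0)

/-- The boundary of `Ω` is of class `C¹` (and `Ω` lies locally on one side of it). -/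
def HasC1Boundary {n : ℕ} (Ω : Set (EuclideanSpace ℝ (Fin n))) : Prop :=
  ∀ z ∈ frontier Ω, ∃ ρ : EuclideanSpace ℝ (Fin n) → ℝ, IsLocalDefiningFunction Ω z ρ

/-- `ν` is the outer unit normal of `Ω` at the boundary point `z`: it is `Dρ(z)/|Dρ(z)|` for a
local defining function `ρ` (this vector does not depend on the choice of `ρ`). -/
def IsOuterUnitNormal {n : ℕ} (Ω : Set (EuclideanSpace ℝ (Fin n)))
    (z ν : EuclideanSpace ℝ (Fin n)) : Prop :=
  ∃ ρ : EuclideanSpace ℝ (Fin n) → ℝ,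
    IsLocalDefiningFunction Ω z ρ ∧ ν = ‖gradient ρ z‖⁻¹ • gradient ρ z

/-- The upper semicontinuous envelope `u^*`, relative to `closure Ω`, of a function which is
bounded above on `closure Ω`; only the values of `u` on `closure Ω` matter. -/
noncomputable def uscEnvelope {n : ℕ} (Ω : Set (EuclideanSpace ℝ (Fin n)))
    (u : EuclideanSpace ℝ (Fin n) → ℝ) (x : EuclideanSpace ℝ (Fin n)) : ℝ :=
  limsup u (𝓝[closure Ω] x)

/-- The lower semicontinuous envelope `u_*`, relative to `closure Ω`, of a function which is
bounded below on `closure Ω`; only the values of `u` on `closure Ω` matter. -/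
noncomputable def lscEnvelope {n : ℕ} (Ω : Set (EuclideanSpace ℝ (Fin n)))
    (u : EuclideanSpace ℝ (Fin n) → ℝ) (x : EuclideanSpace ℝ (Fin n)) : ℝ :=
  liminf u (𝓝[closure Ω] x)

/-- Viscosity subsolutions of `H(x, Du) = a` in `Ω`, `γ · Du = g` on `∂Ω`. The test functions in
`C¹(closure Ω)` are the restrictions of the `C¹` functions on the whole space. -/
def IsSubsolution {n : ℕ} (Ω : Set (EuclideanSpace ℝ (Fin n)))
    (H : EuclideanSpace ℝ (Fin n) → EuclideanSpace ℝ (Fin n) → ℝ)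
    (γ : EuclideanSpace ℝ (Fin n) → EuclideanSpace ℝ (Fin n))
    (g : EuclideanSpace ℝ (Fin n) → ℝ) (a : ℝ) (u : EuclideanSpace ℝ (Fin n) → ℝ) : Prop :=
  BddAbove (u '' closure Ω) ∧
  ∀ x ∈ closure Ω, ∀ φ : EuclideanSpace ℝ (Fin n) → ℝ, ContDiff ℝ 1 φ →
    IsMaxOn (fun y => uscEnvelope Ω u y - φ y) (closure Ω) x →
      (x ∈ Ω → H x (gradient φ x) ≤ a) ∧
      (x ∈ frontier Ω → H x (gradient φ x) ≤ a ∨ inner ℝ (γ x) (gradient φ x) ≤ g x)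

/-- Viscosity supersolutions of `H(x, Du) = a` in `Ω`, `γ · Du = g` on `∂Ω`. -/
def IsSupersolution {n : ℕ} (Ω : Set (EuclideanSpace ℝ (Fin n)))
    (H : EuclideanSpace ℝ (Fin n) → EuclideanSpace ℝ (Fin n) → ℝ)
    (γ : EuclideanSpace ℝ (Fin n) → EuclideanSpace ℝ (Fin n))
    (g : EuclideanSpace ℝ (Fin n) → ℝ) (a : ℝ) (u : EuclideanSpace ℝ (Fin n) → ℝ) : Prop :=
  BddBelow (u '' closure Ω) ∧
  ∀ x ∈ closure Ω, ∀ φ : EuclideanSpace ℝ (Fin n) → ℝ, ContDiff ℝ 1 φ →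
    IsMinOn (fun y => lscEnvelope Ω u y - φ y) (closure Ω) x →
      (x ∈ Ω → a ≤ H x (gradient φ x)) ∧
      (x ∈ frontier Ω → a ≤ H x (gradient φ x) ∨ g x ≤ inner ℝ (γ x) (gradient φ x))

/-- Viscosity solutions: (bounded) functions that are both sub- and supersolutions. -/
def IsViscositySolution {n : ℕ} (Ω : Set (EuclideanSpace ℝ (Fin n)))
    (H : EuclideanSpace ℝ (Fin n) → EuclideanSpace ℝ (Fin n) → ℝ)
    (γ : EuclideanSpace ℝ (Fin n) → EuclideanSpace ℝ (Fin n))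
    (g : EuclideanSpace ℝ (Fin n) → ℝ) (a : ℝ) (u : EuclideanSpace ℝ (Fin n) → ℝ) : Prop :=
  IsSubsolution Ω H γ g a u ∧ IsSupersolution Ω H γ g a u

/-- The critical value (additive eigenvalue): the infimum of all `a` for which the problem with
right-hand side `a` has a subsolution, taken in the extended reals. -/
noncomputable def criticalValue {n : ℕ} (Ω : Set (EuclideanSpace ℝ (Fin n)))
    (H : EuclideanSpace ℝ (Fin n) → EuclideanSpace ℝ (Fin n) → ℝ)
    (γ : EuclideanSpace ℝ (Fin n) → EuclideanSpace ℝ (Fin n))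
    (g : EuclideanSpace ℝ (Fin n) → ℝ) : EReal :=
  sInf {b : EReal | ∃ a : ℝ, b = (a : EReal) ∧
    ∃ u : EuclideanSpace ℝ (Fin n) → ℝ, IsSubsolution Ω H γ g a u}

/-- `d(x, y) = sup {v(x) - v(y)}` over the upper semicontinuous subsolutions `v` of the problem
with right-hand side `0`. -/
noncomputable def subsolutionDist {n : ℕ} (Ω : Set (EuclideanSpace ℝ (Fin n)))
    (H : EuclideanSpace ℝ (Fin n) → EuclideanSpace ℝ (Fin n) → ℝ)
    (γ : EuclideanSpace ℝ (Fin n) → EuclideanSpace ℝ (Fin n))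
    (g : EuclideanSpace ℝ (Fin n) → ℝ) (x y : EuclideanSpace ℝ (Fin n)) : ℝ :=
  sSup {t : ℝ | ∃ v : EuclideanSpace ℝ (Fin n) → ℝ,
    UpperSemicontinuousOn v (closure Ω) ∧ IsSubsolution Ω H γ g 0 v ∧ t = v x - v y}

/-- The Aubry–Mather set of the problem with right-hand side `0`. -/
def aubryMatherSet {n : ℕ} (Ω : Set (EuclideanSpace ℝ (Fin n)))
    (H : EuclideanSpace ℝ (Fin n) → EuclideanSpace ℝ (Fin n) → ℝ)
    (γ : EuclideanSpace ℝ (Fin n) → EuclideanSpace ℝ (Fin n))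
    (g : EuclideanSpace ℝ (Fin n) → ℝ) : Set (EuclideanSpace ℝ (Fin n)) :=
  {y | y ∈ closure Ω ∧ IsViscositySolution Ω H γ g 0 (fun x => subsolutionDist Ω H γ g x y)}

/-! Suppose `u` exceeds `v` somewhere. The set `K` where `u - v` attains its positive maximum is
compact and misses the Aubry–Mather set. Off that set there is room to be strict: at `y` outside it,
some subsolution is strict near `y`. Indeed `d(·, y)` is a supremum of subsolutions, hence a
subsolution, so it must fail the supersolution test at some `z`. There it can be raised by pasting
in the offending test function (`exists_bump`). If `z ≠ y`, the raised function still vanishes at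
`y` and exceeds `d(·, y)` at `z`, against the maximality of `d`. So `z = y`, and the raised function
is strict near `y`. Averaging over a finite cover gives one subsolution `ψ` strict near all of `K`.
For small `m` the maximum of `(1 - m) u + m ψ - v` stays near `K`, where comparison of a strict
subsolution with a supersolution forbids it.

That local comparison, `not_isLocalMaxOn`, must cope with a relaxed oblique condition when the
boundary is only `C¹` and `γ` only continuous. The variables are doubled with the penalty `⟨A ξ, ξ⟩
/ 2ε + k ⟨q, ξ⟩`. At a boundary point `z`, `A (γ z)` is normal to the boundary and `⟨γ z, q⟩ = 1`.
The quadratic part then has a `γ`-derivative of the right sign up to a small error, and `k` places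
the total strictly between the levels at which the boundary alternatives could hold. Only the
inequalities for `H` remain, and convexity of `H` makes them contradictory.

Passing to the limit needs gradients bounded independently of `ε`. This comes from the Lipschitz
estimate `exists_lipschitz`, proved by coercivity and a barrier built from the same `A` and `q`.
Giving each of the two subsolutions its own variable means that convex combinations need not be
known to be subsolutions beforehand; that fact follows by putting a test function in the place of
`v`. -/

/-! ### Calculus of gradients. -/

section Gradient

variable {E : Type*} [NormedAddCommGroup E] [InnerProductSpace ℝ E] [CompleteSpace E]
  {f₁ f₂ : E → ℝ} {p q x : E}

theorem HasGradientAt.fun_add (hf : HasGradientAt f₁ p x) (hg : HasGradientAt f₂ q x) :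
    HasGradientAt (fun y => f₁ y + f₂ y) (p + q) x := by
  rw [hasGradientAt_iff_hasFDerivAt] at *
  rw [map_add]; exact HasFDerivAt.fun_add hf hg

theorem HasGradientAt.fun_sub (hf : HasGradientAt f₁ p x) (hg : HasGradientAt f₂ q x) :
    HasGradientAt (fun y => f₁ y - f₂ y) (p - q) x := by
  rw [hasGradientAt_iff_hasFDerivAt] at *
  rw [map_sub]; exact HasFDerivAt.fun_sub hf hg

theorem HasGradientAt.fun_neg (hf : HasGradientAt f₁ p x) :
    HasGradientAt (fun y => - f₁ y) (-p) x := by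
  rw [hasGradientAt_iff_hasFDerivAt] at *
  rw [map_neg]; exact HasFDerivAt.fun_neg hf

theorem HasGradientAt.fun_const_mul (c : ℝ) (hf : HasGradientAt f₁ p x) :
    HasGradientAt (fun y => c * f₁ y) (c • p) x := by
  rw [hasGradientAt_iff_hasFDerivAt] at *
  simpa using hf.const_mul c

theorem HasGradientAt.comp_real {h : ℝ → ℝ} {h' : ℝ} (hh : HasDerivAt h h' (f₁ x))
    (hf : HasGradientAt f₁ p x) : HasGradientAt (fun y => h (f₁ y)) (h' • p) x := by
  rw [hasGradientAt_iff_hasFDerivAt] at *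
  rw [map_smulₛₗ]; exact hh.comp_hasFDerivAt x hf

theorem hasGradientAt_inner_left (b y : E) :
    HasGradientAt (fun x => (inner ℝ b (x - y) : ℝ)) b x := by
  rw [hasGradientAt_iff_hasFDerivAt]
  have h : HasFDerivAt (fun x : E => x - y) (ContinuousLinearMap.id ℝ E) x :=
    (hasFDerivAt_id x).sub_const y
  exact ((InnerProductSpace.toDual ℝ E b).hasFDerivAt (x := x - y)).comp x h

theorem hasGradientAt_quadratic (A : E →L[ℝ] E) (hA : ∀ ξ η, inner ℝ (A ξ) η = inner ℝ ξ (A η))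
    (y : E) : HasGradientAt (fun x => (inner ℝ (A (x - y)) (x - y) : ℝ)) ((2 : ℝ) • A (x - y)) x := by
  rw [hasGradientAt_iff_hasFDerivAt]
  have h : HasFDerivAt (fun x : E => x - y) (ContinuousLinearMap.id ℝ E) x :=
    (hasFDerivAt_id x).sub_const y
  have h2 := (A.hasFDerivAt (x := x - y)).comp x h
  have h3 := HasFDerivAt.inner ℝ h2 h
  refine h3.congr_fderiv ?_
  ext v
  have e1 := hA v (x - y)
  have e2 := real_inner_comm v (A (x - y))
  simp only [ContinuousLinearMap.comp_id, Function.comp_apply, ContinuousLinearMap.comp_apply,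
    ContinuousLinearMap.prod_apply, ContinuousLinearMap.id_apply, fderivInnerCLM_apply,
    InnerProductSpace.toDual_apply_apply, inner_smul_left, RCLike.conj_to_real]
  linarith

theorem hasGradientAt_norm_sq_sub (y : E) :
    HasGradientAt (fun x => ‖x - y‖ ^ 2) ((2 : ℝ) • (x - y)) x := by
  have := hasGradientAt_quadratic (x := x) (ContinuousLinearMap.id ℝ E) (fun _ _ => rfl) y
  simpa [real_inner_self_eq_norm_sq] using this

theorem ContDiffAt.hasGradientAt (h : ContDiffAt ℝ 1 f₁ x) :
    HasGradientAt f₁ (gradient f₁ x) x :=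
  (h.differentiableAt (by simp)).hasGradientAt

theorem ContDiffAt.continuousAt_gradient (h : ContDiffAt ℝ 1 f₁ x) :
    ContinuousAt (gradient f₁) x := by
  have := h.continuousAt_fderiv (by simp)
  exact (InnerProductSpace.toDual ℝ E).symm.continuous.continuousAt.comp this

end Gradient

/-! ### Test functions: from local to global. -/

/-- A function touching `f` locally from above on `S` can be replaced by a globally smooth one
touching `f` globally on `S`. -/
theorem exists_contDiff_isMaxOn {E : Type*} [NormedAddCommGroup E]
    [InnerProductSpace ℝ E] [FiniteDimensional ℝ E] {S : Set E} {f φ : E → ℝ} {x : E}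
    (hf : BddAbove (f '' S)) (hφ : ContDiffAt ℝ 1 φ x)
    (hmax : IsLocalMaxOn (fun y => f y - φ y) S x) :
    ∃ ψ : E → ℝ, ContDiff ℝ 1 ψ ∧ ψ =ᶠ[𝓝 x] φ ∧ IsMaxOn (fun y => f y - ψ y) S x := by
  obtain ⟨B, hB⟩ := hf
  have h1 := hφ.eventually (by simp)
  have h2 : ∀ᶠ y in 𝓝 x, y ∈ S → f y - φ y ≤ f x - φ x := eventually_nhdsWithin_iff.1 hmax
  obtain ⟨r, hr, hball⟩ := Metric.eventually_nhds_iff_ball.1 (h1.and h2)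
  let χ : ContDiffBump x := ⟨r / 4, r / 2, by linarith, by linarith⟩
  -- The new function is `χ φ + (1 - χ) M`. The constant `M` is chosen so that `f - M ≤ f x - φ x`
  -- on all of `S`, so both ends of the interpolation respect the maximum.
  set M : ℝ := B - (f x - φ x) with hM
  have hχ : ∀ y, y ∈ Metric.ball x r ∨ χ =ᶠ[𝓝 y] 0 := by
    intro y
    by_cases hy : y ∈ tsupport χ
    · left
      rw [χ.tsupport_eq] at hy
      exact Metric.closedBall_subset_ball (by show r / 2 < r; linarith) hy
    · right; exact notMem_tsupport_iff_eventuallyEq.1 hy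
  refine ⟨fun y => χ y * (φ y - M) + M, ?_, ?_, ?_⟩
  · rw [contDiff_iff_contDiffAt]
    intro y
    refine ContDiffAt.add ?_ contDiffAt_const
    rcases hχ y with hy | hy
    · exact χ.contDiffAt.mul ((hball y hy).1.sub contDiffAt_const)
    · have : (fun y => χ y * (φ y - M)) =ᶠ[𝓝 y] fun _ => 0 := by
        filter_upwards [hy] with z hz
        simp [hz]
      exact contDiffAt_const.congr_of_eventuallyEq this
  · filter_upwards [χ.eventuallyEq_one] with y hy
    simp [hy]
  · intro y hy
    have hone : χ x = 1 := χ.eventuallyEq_one.eq_of_nhds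
    simp only [mem_ofPred_eq, hone]
    have hfy : f y ≤ B := hB ⟨y, hy, rfl⟩
    have hc0 := χ.nonneg (x := y)
    have hc1 := χ.le_one (x := y)
    rcases hχ y with hyb | hyb
    · have := (hball y hyb).2 hy
      nlinarith
    · have : χ y = 0 := hyb.eq_of_nhds
      rw [this]; linarith

/-! ### Semicontinuous functions equal their envelopes. -/

section Envelope

variable {n : ℕ} {Ω : Set (EuclideanSpace ℝ (Fin n))} {u : EuclideanSpace ℝ (Fin n) → ℝ}
  {x : EuclideanSpace ℝ (Fin n)}

/-- Since `x` itself lies in every neighbourhood within `closure Ω`, every eventual upper bound is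
at least `u x`; semicontinuity supplies bounds arbitrarily close to it. These two facts also make
the real infimum genuine rather than a default value. -/
theorem uscEnvelope_eq (hu : UpperSemicontinuousOn u (closure Ω)) (hx : x ∈ closure Ω) :
    uscEnvelope Ω u x = u x := by
  unfold uscEnvelope
  rw [limsup_eq]
  have hlb : ∀ a ∈ {a | ∀ᶠ y in 𝓝[closure Ω] x, u y ≤ a}, u x ≤ a :=
    fun a ha => (mem_of_mem_nhdsWithin hx ha : _)
  have hmem : ∀ a, u x < a → a ∈ {a | ∀ᶠ y in 𝓝[closure Ω] x, u y ≤ a} :=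
    fun a ha => ((hu x hx) a ha).mono fun y hy => hy.le
  refine le_antisymm ?_ (le_csInf ⟨u x + 1, hmem _ (by linarith)⟩ hlb)
  refine le_of_forall_gt fun a ha => ?_
  obtain ⟨b, hb, hba⟩ := exists_between ha
  exact (csInf_le ⟨u x, hlb⟩ (hmem b hb)).trans_lt hba

theorem lscEnvelope_eq (hu : LowerSemicontinuousOn u (closure Ω)) (hx : x ∈ closure Ω) :
    lscEnvelope Ω u x = u x := by
  unfold lscEnvelope
  rw [liminf_eq]
  have hub : ∀ a ∈ {a | ∀ᶠ y in 𝓝[closure Ω] x, a ≤ u y}, a ≤ u x :=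
    fun a ha => (mem_of_mem_nhdsWithin hx ha : _)
  have hmem : ∀ a, a < u x → a ∈ {a | ∀ᶠ y in 𝓝[closure Ω] x, a ≤ u y} :=
    fun a ha => ((hu x hx) a ha).mono fun y hy => hy.le
  refine le_antisymm (csSup_le ⟨u x - 1, hmem _ (by linarith)⟩ hub) ?_
  refine le_of_forall_lt fun a ha => ?_
  obtain ⟨b, hb, hba⟩ := exists_between ha
  exact hb.trans_le (le_csSup ⟨u x, hub⟩ (hmem b hba))

end Envelope

/-! ### Localized and relaxed viscosity inequalities. -/

/-- The standing assumptions on the domain, the Hamiltonian and the boundary data. -/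
structure IsNeumannProblem {n : ℕ} (Ω : Set (EuclideanSpace ℝ (Fin n)))
    (H : EuclideanSpace ℝ (Fin n) → EuclideanSpace ℝ (Fin n) → ℝ)
    (γ : EuclideanSpace ℝ (Fin n) → EuclideanSpace ℝ (Fin n))
    (g : EuclideanSpace ℝ (Fin n) → ℝ) : Prop where
  isOpen : IsOpen Ω
  isConnected : IsConnected Ω
  isBounded : Bornology.IsBounded Ω
  hasC1Boundary : HasC1Boundary Ω
  continuousOn_H :
    ContinuousOn (fun q : EuclideanSpace ℝ (Fin n) × EuclideanSpace ℝ (Fin n) => H q.1 q.2)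
      (closure Ω ×ˢ Set.univ)
  continuousOn_γ : ContinuousOn γ (frontier Ω)
  continuousOn_g : ContinuousOn g (frontier Ω)
  convexOn : ∀ x ∈ closure Ω, ConvexOn ℝ Set.univ (H x)
  coercive : ∀ x ∈ closure Ω,
    Tendsto (H x) (Bornology.cobounded (EuclideanSpace ℝ (Fin n))) atTop
  oblique : ∀ x ∈ frontier Ω, ∀ ν : EuclideanSpace ℝ (Fin n),
      IsOuterUnitNormal Ω x ν → 0 < inner ℝ ν (γ x)

/-- The subsolution inequality at `x` for the gradient `p`, with both the equation and the boundary
condition relaxed by `s`. -/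
def SubAt {n : ℕ} (Ω : Set (EuclideanSpace ℝ (Fin n)))
    (H : EuclideanSpace ℝ (Fin n) → EuclideanSpace ℝ (Fin n) → ℝ)
    (γ : EuclideanSpace ℝ (Fin n) → EuclideanSpace ℝ (Fin n))
    (g : EuclideanSpace ℝ (Fin n) → ℝ) (s : ℝ) (x p : EuclideanSpace ℝ (Fin n)) : Prop :=
  H x p ≤ s ∨ (x ∈ frontier Ω ∧ inner ℝ (γ x) p ≤ g x + s)

/-- The supersolution inequality at `x` for the gradient `p`, with both the equation and the
boundary condition shifted by `s`. -/
def SuperAt {n : ℕ} (Ω : Set (EuclideanSpace ℝ (Fin n)))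
    (H : EuclideanSpace ℝ (Fin n) → EuclideanSpace ℝ (Fin n) → ℝ)
    (γ : EuclideanSpace ℝ (Fin n) → EuclideanSpace ℝ (Fin n))
    (g : EuclideanSpace ℝ (Fin n) → ℝ) (s : ℝ) (x p : EuclideanSpace ℝ (Fin n)) : Prop :=
  s ≤ H x p ∨ (x ∈ frontier Ω ∧ g x + s ≤ inner ℝ (γ x) p)

/-- Viscosity subsolutions, localized to `U` and tested with local maxima. -/
def SubOn {n : ℕ} (Ω : Set (EuclideanSpace ℝ (Fin n)))
    (H : EuclideanSpace ℝ (Fin n) → EuclideanSpace ℝ (Fin n) → ℝ)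
    (γ : EuclideanSpace ℝ (Fin n) → EuclideanSpace ℝ (Fin n))
    (g : EuclideanSpace ℝ (Fin n) → ℝ) (U : Set (EuclideanSpace ℝ (Fin n))) (s : ℝ)
    (w : EuclideanSpace ℝ (Fin n) → ℝ) : Prop :=
  ∀ x ∈ closure Ω, x ∈ U → ∀ φ : EuclideanSpace ℝ (Fin n) → ℝ, ∀ p, ContDiffAt ℝ 1 φ x →
    HasGradientAt φ p x → IsLocalMaxOn (fun y => w y - φ y) (closure Ω) x → SubAt Ω H γ g s x p

/-- Viscosity supersolutions, localized to `U` and tested with local minima. -/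
def SuperOn {n : ℕ} (Ω : Set (EuclideanSpace ℝ (Fin n)))
    (H : EuclideanSpace ℝ (Fin n) → EuclideanSpace ℝ (Fin n) → ℝ)
    (γ : EuclideanSpace ℝ (Fin n) → EuclideanSpace ℝ (Fin n))
    (g : EuclideanSpace ℝ (Fin n) → ℝ) (U : Set (EuclideanSpace ℝ (Fin n))) (s : ℝ)
    (w : EuclideanSpace ℝ (Fin n) → ℝ) : Prop :=
  ∀ x ∈ closure Ω, x ∈ U → ∀ φ : EuclideanSpace ℝ (Fin n) → ℝ, ∀ p, ContDiffAt ℝ 1 φ x →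
    HasGradientAt φ p x → IsLocalMinOn (fun y => w y - φ y) (closure Ω) x → SuperAt Ω H γ g s x p

section Basic

variable {n : ℕ} {Ω : Set (EuclideanSpace ℝ (Fin n))}
  {H : EuclideanSpace ℝ (Fin n) → EuclideanSpace ℝ (Fin n) → ℝ}
  {γ : EuclideanSpace ℝ (Fin n) → EuclideanSpace ℝ (Fin n)}
  {g : EuclideanSpace ℝ (Fin n) → ℝ}
  {u v : EuclideanSpace ℝ (Fin n) → ℝ} {U V : Set (EuclideanSpace ℝ (Fin n))} {s t : ℝ}

theorem SubOn.mono (h : SubOn Ω H γ g U s u) (hV : V ⊆ U) (hs : s ≤ t) :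
    SubOn Ω H γ g V t u := by
  intro x hx hxV φ p hφ hp hm
  rcases h x hx (hV hxV) φ p hφ hp hm with h | h
  · exact Or.inl (h.trans hs)
  · exact Or.inr ⟨h.1, by linarith [h.2]⟩

theorem SuperOn.mono (h : SuperOn Ω H γ g U s u) (hV : V ⊆ U) (hs : t ≤ s) :
    SuperOn Ω H γ g V t u := by
  intro x hx hxV φ p hφ hp hm
  rcases h x hx (hV hxV) φ p hφ hp hm with h | h
  · exact Or.inl (hs.trans h)
  · exact Or.inr ⟨h.1, by linarith [h.2]⟩

namespace IsNeumannProblem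

theorem isCompact_closure (hP : IsNeumannProblem Ω H γ g) : IsCompact (closure Ω) :=
  hP.isBounded.isCompact_closure

theorem notMem_frontier (hP : IsNeumannProblem Ω H γ g) {x : EuclideanSpace ℝ (Fin n)}
    (hx : x ∈ Ω) : x ∉ frontier Ω := by
  rw [hP.isOpen.frontier_eq]
  exact fun h => h.2 hx

theorem mem_or_mem_frontier (hP : IsNeumannProblem Ω H γ g) {x : EuclideanSpace ℝ (Fin n)}
    (hx : x ∈ closure Ω) : x ∈ Ω ∨ x ∈ frontier Ω := by
  rw [hP.isOpen.frontier_eq]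
  by_cases h : x ∈ Ω
  · exact Or.inl h
  · exact Or.inr ⟨hx, h⟩

end IsNeumannProblem

/-- Removes the envelope and allows tests that are smooth and touching only locally. The later
arguments need this, since their maxima are taken over small sets and the barrier is smooth only off
its vertex. -/
theorem IsSubsolution.subOn (hP : IsNeumannProblem Ω H γ g)
    (hu : UpperSemicontinuousOn u (closure Ω)) (h : IsSubsolution Ω H γ g 0 u) :
    SubOn Ω H γ g univ 0 u := by
  intro x hx _ φ p hφ hp hm
  obtain ⟨ψ, hψ, hψφ, hmax⟩ := exists_contDiff_isMaxOn h.1 hφ hm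
  have hgrad : gradient ψ x = p := (hp.congr_of_eventuallyEq hψφ).gradient
  have key := h.2 x hx ψ hψ (by
    intro y hy
    have := hmax hy
    simpa only [mem_ofPred_eq, uscEnvelope_eq hu hx, uscEnvelope_eq hu hy] using this)
  rw [hgrad] at key
  rcases hP.mem_or_mem_frontier hx with hx' | hx'
  · exact Or.inl (key.1 hx')
  · rcases key.2 hx' with h | h
    · exact Or.inl h
    · exact Or.inr ⟨hx', by simpa using h⟩

theorem SubOn.isSubsolution (hP : IsNeumannProblem Ω H γ g)
    (hu : UpperSemicontinuousOn u (closure Ω)) (h : SubOn Ω H γ g univ 0 u) :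
    IsSubsolution Ω H γ g 0 u := by
  refine ⟨hu.bddAbove_of_isCompact hP.isCompact_closure, fun x hx φ hφ hmax => ?_⟩
  have hm : IsMaxOn (fun y => u y - φ y) (closure Ω) x := by
    intro y hy
    have := hmax hy
    simpa only [mem_ofPred_eq, uscEnvelope_eq hu hx, uscEnvelope_eq hu hy] using this
  have key := h x hx (mem_univ x) φ _ hφ.contDiffAt hφ.contDiffAt.hasGradientAt hm.localize
  refine ⟨fun hxΩ => ?_, fun hxΓ => ?_⟩
  · exact key.resolve_right fun h => hP.notMem_frontier hxΩ h.1
  · exact key.imp id fun h => by simpa using h.2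

theorem IsSupersolution.superOn (hP : IsNeumannProblem Ω H γ g)
    (hu : LowerSemicontinuousOn u (closure Ω)) (h : IsSupersolution Ω H γ g 0 u) :
    SuperOn Ω H γ g univ 0 u := by
  intro x hx _ φ p hφ hp hm
  have hb : BddAbove ((fun y => - u y) '' closure Ω) := by
    obtain ⟨b, hb⟩ := h.1
    refine ⟨-b, ?_⟩
    rintro _ ⟨y, hy, rfl⟩
    exact neg_le_neg (hb ⟨y, hy, rfl⟩)
  have hm' : IsLocalMaxOn (fun y => - u y - - φ y) (closure Ω) x := by
    filter_upwards [hm] with y hy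
    linarith
  obtain ⟨ψ, hψ, hψφ, hmax⟩ := exists_contDiff_isMaxOn hb hφ.neg hm'
  have hgrad : gradient (fun y => - ψ y) x = p := by
    have : HasGradientAt (fun y => - ψ y) p x := by
      refine hp.congr_of_eventuallyEq ?_
      filter_upwards [hψφ] with y hy
      simp [hy]
    exact this.gradient
  have key := h.2 x hx (fun y => - ψ y) hψ.neg (by
    intro y hy
    have := hmax hy
    simp only [mem_ofPred_eq, lscEnvelope_eq hu hx, lscEnvelope_eq hu hy] at this ⊢
    linarith)
  rw [hgrad] at key
  rcases hP.mem_or_mem_frontier hx with hx' | hx'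
  · exact Or.inl (key.1 hx')
  · rcases key.2 hx' with h | h
    · exact Or.inl h
    · exact Or.inr ⟨hx', by simpa using h⟩

end Basic

/-! ### Geometry of the boundary and of the oblique field. -/

section Geometry

variable {n : ℕ} {Ω : Set (EuclideanSpace ℝ (Fin n))}
  {H : EuclideanSpace ℝ (Fin n) → EuclideanSpace ℝ (Fin n) → ℝ}
  {γ : EuclideanSpace ℝ (Fin n) → EuclideanSpace ℝ (Fin n)}
  {g : EuclideanSpace ℝ (Fin n) → ℝ} {z : EuclideanSpace ℝ (Fin n)}
  {ρ : EuclideanSpace ℝ (Fin n) → ℝ}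

/-- Near a boundary point, `Ω` lies up to first order on one side of its tangent planes. -/
theorem IsLocalDefiningFunction.neg_le_inner (hΩ : IsOpen Ω)
    (hρ : IsLocalDefiningFunction Ω z ρ) {κ : ℝ} (hκ : 0 < κ) :
    ∃ r > 0, ∀ x ∈ frontier Ω, x ∈ Metric.ball z r → ∀ y ∈ closure Ω, y ∈ Metric.ball z r →
      -(κ * ‖x - y‖) ≤ inner ℝ (gradient ρ z) (x - y) := by
  obtain ⟨hρC, -, hev⟩ := hρ
  -- Strict differentiability controls `ρ x - ρ y` uniformly over pairs near `z`, and `ρ x ≥ 0 ≥ ρ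
  -- y` for `x` on the boundary and `y` in the closure.
  have hs := hρC.contDiffAt.hasStrictFDerivAt (x := z) (by simp)
  have hlit := hs.isLittleO.def hκ
  rw [nhds_prod_eq] at hlit
  obtain ⟨r₁, hr₁, h₁⟩ := Metric.eventually_nhds_iff_ball.1 hev
  obtain ⟨r₂, hr₂, h₂⟩ := Metric.eventually_nhds_iff_ball.1
    (show ∀ᶠ q in 𝓝 (z, z), _ from by rw [nhds_prod_eq]; exact hlit)
  refine ⟨min r₁ r₂, lt_min hr₁ hr₂, fun x hx hxr y hy hyr => ?_⟩
  have hle : ∀ y ∈ closure Ω, y ∈ Metric.ball z (min r₁ r₂) → ρ y ≤ 0 := by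
    intro y hy hyr
    by_contra hcon
    push Not at hcon
    have hpos : ∀ᶠ w in 𝓝 y, 0 < ρ w := hρC.continuous.continuousAt.eventually_const_lt hcon
    have hball : ∀ᶠ w in 𝓝 y, w ∈ Metric.ball z r₁ :=
      Metric.isOpen_ball.mem_nhds (Metric.ball_subset_ball (min_le_left _ _) hyr)
    obtain ⟨w, hwΩ, hw, hwb⟩ :=
      ((mem_closure_iff_frequently.1 hy).and_eventually (hpos.and hball)).exists
    exact absurd ((h₁ w hwb).1 hwΩ) (by linarith)
  have hx0 : 0 ≤ ρ x := by
    by_contra hcon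
    push Not at hcon
    rw [hΩ.frontier_eq] at hx
    exact hx.2 ((h₁ x (Metric.ball_subset_ball (min_le_left _ _) hxr)).2 hcon)
  have hy0 := hle y hy hyr
  have hmem : (x, y) ∈ Metric.ball (z, z) r₂ := by
    rw [← ball_prod_same]
    exact ⟨Metric.ball_subset_ball (min_le_right _ _) hxr,
      Metric.ball_subset_ball (min_le_right _ _) hyr⟩
  have h := h₂ _ hmem
  rw [Real.norm_eq_abs] at h
  have h' := (abs_le.1 h).2
  rw [inner_gradient_left]
  simp only at h'
  linarith

theorem IsNeumannProblem.exists_defining (hP : IsNeumannProblem Ω H γ g) (hz : z ∈ frontier Ω) :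
    ∃ ρ, IsLocalDefiningFunction Ω z ρ ∧ 0 < (inner ℝ (gradient ρ z) (γ z) : ℝ) := by
  obtain ⟨ρ, hρ⟩ := hP.hasC1Boundary z hz
  refine ⟨ρ, hρ, ?_⟩
  have h := hP.oblique z hz _ ⟨ρ, hρ, rfl⟩
  rw [real_inner_smul_left] at h
  exact pos_of_mul_pos_right h (inv_nonneg.2 (norm_nonneg _))

/-- The vector field `-γ` points into `Ω`. -/
theorem IsNeumannProblem.eventually_sub_smul_mem (hP : IsNeumannProblem Ω H γ g)
    (hz : z ∈ frontier Ω) : ∀ᶠ t in 𝓝[>] (0 : ℝ), z - t • γ z ∈ Ω := by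
  obtain ⟨ρ, hρ, hpos⟩ := hP.exists_defining hz
  obtain ⟨r, hr, hle⟩ := hρ.neg_le_inner hP.isOpen one_pos
  have hz0 : ρ z ≤ 0 := by
    by_contra hcon
    push Not at hcon
    have h1 : ∀ᶠ w in 𝓝 z, 0 < ρ w := hρ.1.continuous.continuousAt.eventually_const_lt hcon
    obtain ⟨w, hw, hw1, hw2⟩ := ((mem_closure_iff_frequently.1
      (frontier_subset_closure hz)).and_eventually (h1.and hρ.2.2)).exists
    exact absurd (hw2.1 hw) (by linarith)
  have hline : HasDerivAt (fun t : ℝ => z - t • γ z) (-γ z) 0 := by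
    simpa using ((hasDerivAt_id (0 : ℝ)).smul_const (γ z)).const_sub z
  have hgr : HasFDerivAt ρ (fderiv ℝ ρ z) (z - (0 : ℝ) • γ z) := by
    simpa using (hρ.1.differentiable (by simp) z).hasFDerivAt
  have hd : HasDerivAt (fun t : ℝ => ρ (z - t • γ z)) (-(inner ℝ (gradient ρ z) (γ z))) 0 := by
    have := hgr.comp_hasDerivAt (0 : ℝ) hline
    simpa [inner_gradient_left, Function.comp_def] using this
  have hslope := hd.tendsto_slope_zero_right
  have hneg : ∀ᶠ t in 𝓝[>] (0 : ℝ), t⁻¹ • (ρ (z - (0 + t) • γ z) - ρ (z - (0 : ℝ) • γ z)) < 0 :=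
    hslope.eventually_lt_const (by linarith)
  have hcont : Tendsto (fun t : ℝ => z - t • γ z) (𝓝[>] 0) (𝓝 z) := by
    have : Tendsto (fun t : ℝ => z - t • γ z) (𝓝 0) (𝓝 (z - (0 : ℝ) • γ z)) :=
      (by fun_prop : Continuous fun t : ℝ => z - t • γ z).tendsto 0
    simp only [zero_smul, sub_zero] at this
    exact this.mono_left nhdsWithin_le_nhds
  filter_upwards [hneg, hcont.eventually hρ.2.2, self_mem_nhdsWithin] with t ht ht2 ht0
  have ht0 : 0 < t := ht0
  rw [ht2]
  simp only [zero_add, zero_smul, sub_zero, smul_eq_mul] at ht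
  have := (mul_neg_iff.1 ht).resolve_right (fun h => absurd h.1 (by
    have := inv_pos.2 ht0; linarith))
  linarith [this.2]

/-- A quadratic form adapted to the oblique derivative at `z`. -/
theorem IsNeumannProblem.exists_oblique_form (hP : IsNeumannProblem Ω H γ g)
    (hz : z ∈ closure Ω) :
    ∃ (A : EuclideanSpace ℝ (Fin n) →L[ℝ] EuclideanSpace ℝ (Fin n)) (c : ℝ)
      (q : EuclideanSpace ℝ (Fin n)) (G : ℝ), 0 < c ∧
      (∀ ξ η, (inner ℝ (A ξ) η : ℝ) = inner ℝ ξ (A η)) ∧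
      (∀ ξ, c * ‖ξ‖ ^ 2 ≤ inner ℝ (A ξ) ξ) ∧
      ∀ κ > 0, ∃ r > 0, ∀ x ∈ frontier Ω, x ∈ Metric.ball z r →
        ‖γ x‖ ≤ G ∧ |(inner ℝ (γ x) q : ℝ) - 1| ≤ κ ∧ |g x - g z| ≤ κ ∧
        ∀ y ∈ closure Ω, y ∈ Metric.ball z r → -(κ * ‖x - y‖) ≤ inner ℝ (γ x) (A (x - y)) := by
  rcases hP.mem_or_mem_frontier hz with hzΩ | hzΓ
  · obtain ⟨r, hr, hb⟩ := Metric.isOpen_iff.1 hP.isOpen z hzΩ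
    refine ⟨ContinuousLinearMap.id ℝ _, 1, 0, 0, one_pos, fun _ _ => rfl, fun ξ => ?_,
      fun κ _ => ⟨r, hr, fun x hx hxr => absurd hx (hP.notMem_frontier (hb hxr))⟩⟩
    simp
  obtain ⟨ρ, hρ, hpos⟩ := hP.exists_defining hzΓ
  set m := gradient ρ z with hm
  set c₀ : ℝ := inner ℝ m (γ z) with hc₀
  -- `P` is the projection along `γ z` onto the tangent hyperplane. With `A = m mᵀ + Pᵀ P` one gets
  -- `A (γ z) = c₀ m`, because `P` kills `γ z`; and `A` is positive definite, because `P ξ` and `⟨m,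
  -- ξ⟩` together determine `ξ`.
  let P : EuclideanSpace ℝ (Fin n) →L[ℝ] EuclideanSpace ℝ (Fin n) :=
    ContinuousLinearMap.id ℝ _ - (innerSL ℝ m).smulRight (c₀⁻¹ • γ z)
  have hPa : ∀ ξ, P ξ = ξ - (inner ℝ m ξ : ℝ) • (c₀⁻¹ • γ z) := fun ξ => by simp [P]
  have hPγ : P (γ z) = 0 := by
    rw [hPa, smul_smul, ← hc₀, mul_inv_cancel₀ hpos.ne', one_smul, sub_self]
  let A : EuclideanSpace ℝ (Fin n) →L[ℝ] EuclideanSpace ℝ (Fin n) :=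
    (innerSL ℝ m).smulRight m + (ContinuousLinearMap.adjoint P) ∘L P
  have hA1 : ∀ ξ η, (inner ℝ (A ξ) η : ℝ) = inner ℝ m ξ * inner ℝ m η + inner ℝ (P ξ) (P η) := by
    intro ξ η
    simp [A, inner_add_left, real_inner_smul_left, ContinuousLinearMap.adjoint_inner_left]
  have hAsym : ∀ ξ η, (inner ℝ (A ξ) η : ℝ) = inner ℝ ξ (A η) := by
    intro ξ η
    rw [real_inner_comm (A η) ξ, hA1, hA1, real_inner_comm (P ξ)]
    ring
  have hAγ : ∀ ξ, (inner ℝ (γ z) (A ξ) : ℝ) = c₀ * inner ℝ m ξ := by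
    intro ξ
    rw [← hAsym, hA1, hPγ]
    simp [hc₀]
  set G₀ : ℝ := ‖c₀⁻¹ • γ z‖ with hG₀
  have hcoer : ∀ ξ, (2 * (1 + G₀ ^ 2))⁻¹ * ‖ξ‖ ^ 2 ≤ inner ℝ (A ξ) ξ := by
    intro ξ
    rw [hA1, real_inner_self_eq_norm_sq, inv_mul_le_iff₀ (by positivity)]
    have h1 : ‖ξ‖ ≤ ‖P ξ‖ + |(inner ℝ m ξ : ℝ)| * G₀ := by
      have : ξ = P ξ + (inner ℝ m ξ : ℝ) • (c₀⁻¹ • γ z) := by rw [hPa]; abel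
      calc ‖ξ‖ = ‖P ξ + (inner ℝ m ξ : ℝ) • (c₀⁻¹ • γ z)‖ := by rw [← this]
        _ ≤ _ := (norm_add_le _ _).trans (by rw [norm_smul, Real.norm_eq_abs])
    set a := ‖P ξ‖
    have hsq : |(inner ℝ m ξ : ℝ)| ^ 2 = inner ℝ m ξ ^ 2 := sq_abs _
    set b := |(inner ℝ m ξ : ℝ)|
    have h2 : ‖ξ‖ ^ 2 ≤ (a + b * G₀) ^ 2 := pow_le_pow_left₀ (norm_nonneg _) h1 2
    nlinarith [sq_nonneg (a - b * G₀), sq_nonneg b, sq_nonneg (a * G₀), sq_nonneg a, sq_nonneg G₀]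
  refine ⟨A, (2 * (1 + G₀ ^ 2))⁻¹, c₀⁻¹ • m, ‖γ z‖ + 1, by positivity, hAsym, hcoer,
    fun κ hκ => ?_⟩
  set q := c₀⁻¹ • m with hq
  have hγq : (inner ℝ (γ z) q : ℝ) = 1 := by
    rw [hq, real_inner_smul_right, real_inner_comm, ← hc₀, inv_mul_cancel₀ hpos.ne']
  obtain ⟨r₁, hr₁, h₁⟩ := hρ.neg_le_inner hP.isOpen (κ := κ / (2 * c₀)) (by positivity)
  set δ : ℝ := min 1 (min (κ / (‖q‖ + 1)) (κ / (2 * (‖A‖ + 1)))) with hδ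
  have hδ0 : 0 < δ := by
    refine lt_min one_pos (lt_min ?_ ?_) <;> positivity
  obtain ⟨r₂, hr₂, h₂⟩ := Metric.continuousWithinAt_iff.1 (hP.continuousOn_γ z hzΓ) δ hδ0
  obtain ⟨r₃, hr₃, h₃⟩ := Metric.continuousWithinAt_iff.1 (hP.continuousOn_g z hzΓ) κ hκ
  refine ⟨min r₁ (min r₂ r₃), lt_min hr₁ (lt_min hr₂ hr₃), fun x hx hxr => ?_⟩
  have hxr₁ : x ∈ Metric.ball z r₁ := Metric.ball_subset_ball (min_le_left _ _) hxr
  have hγx : ‖γ x - γ z‖ ≤ δ := by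
    rw [← dist_eq_norm]
    exact (h₂ hx (lt_of_lt_of_le hxr ((min_le_right _ _).trans (min_le_left _ _)))).le
  have hgx : |g x - g z| ≤ κ := by
    rw [← Real.dist_eq]
    exact (h₃ hx (lt_of_lt_of_le hxr ((min_le_right _ _).trans (min_le_right _ _)))).le
  refine ⟨?_, ?_, hgx, fun y hy hyr => ?_⟩
  · have : ‖γ x‖ ≤ ‖γ x - γ z‖ + ‖γ z‖ := norm_le_norm_sub_add _ _
    linarith [min_le_left 1 (min (κ / (‖q‖ + 1)) (κ / (2 * (‖A‖ + 1))))]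
  · have e : (inner ℝ (γ x) q : ℝ) - 1 = inner ℝ (γ x - γ z) q := by
      rw [inner_sub_left, hγq]
    rw [e]
    refine (abs_real_inner_le_norm _ _).trans ?_
    have hδκ : δ ≤ κ / (‖q‖ + 1) := (min_le_right _ _).trans (min_le_left _ _)
    rw [le_div_iff₀ (by positivity)] at hδκ
    nlinarith [norm_nonneg q, norm_nonneg (γ x - γ z)]
  · have e : (inner ℝ (γ x) (A (x - y)) : ℝ)
        = c₀ * inner ℝ m (x - y) + inner ℝ (γ x - γ z) (A (x - y)) := by
      rw [inner_sub_left, hAγ]; ring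
    have k1 := h₁ x hx hxr₁ y hy (Metric.ball_subset_ball (min_le_left _ _) hyr)
    have k2 := neg_le_of_abs_le (abs_real_inner_le_norm (γ x - γ z) (A (x - y)))
    have k3 : ‖γ x - γ z‖ * ‖A (x - y)‖ ≤ κ / 2 * ‖x - y‖ := by
      have hδκ : δ ≤ κ / (2 * (‖A‖ + 1)) := (min_le_right _ _).trans (min_le_right _ _)
      rw [le_div_iff₀ (by positivity)] at hδκ
      calc ‖γ x - γ z‖ * ‖A (x - y)‖ ≤ δ * (‖A‖ * ‖x - y‖) :=
            mul_le_mul hγx (A.le_opNorm _) (norm_nonneg _) hδ0.le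
        _ = (δ * ‖A‖) * ‖x - y‖ := by ring
        _ ≤ κ / 2 * ‖x - y‖ := by
            refine mul_le_mul_of_nonneg_right ?_ (norm_nonneg _)
            nlinarith
    have k4 : c₀ * -(κ / (2 * c₀) * ‖x - y‖) ≤ c₀ * inner ℝ m (x - y) :=
      mul_le_mul_of_nonneg_left k1 hpos.le
    have k5 : c₀ * -(κ / (2 * c₀) * ‖x - y‖) = - (κ / 2 * ‖x - y‖) := by
      field_simp
    rw [e]
    linarith

end Geometry

/-! ### Coercivity and the Lipschitz estimate. -/

namespace IsNeumannProblem

variable {n : ℕ} {Ω : Set (EuclideanSpace ℝ (Fin n))}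
  {H : EuclideanSpace ℝ (Fin n) → EuclideanSpace ℝ (Fin n) → ℝ}
  {γ : EuclideanSpace ℝ (Fin n) → EuclideanSpace ℝ (Fin n)}
  {g : EuclideanSpace ℝ (Fin n) → ℝ} {z : EuclideanSpace ℝ (Fin n)}

theorem exists_uniform_H (hP : IsNeumannProblem Ω H γ g) (R : ℝ) {σ : ℝ} (hσ : 0 < σ) :
    ∃ τ > 0, ∀ x ∈ closure Ω, ∀ y ∈ closure Ω, ‖x - y‖ < τ → ∀ p p', ‖p‖ ≤ R → ‖p'‖ ≤ R →
      ‖p - p'‖ < τ → H x p ≤ H y p' + σ := by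
  have hK : IsCompact (closure Ω ×ˢ Metric.closedBall (0 : EuclideanSpace ℝ (Fin n)) R) :=
    hP.isCompact_closure.prod (isCompact_closedBall _ _)
  have hU := hK.uniformContinuousOn_of_continuous
    (hP.continuousOn_H.mono (prod_mono subset_rfl (subset_univ _)))
  obtain ⟨τ, hτ, h⟩ := Metric.uniformContinuousOn_iff.1 hU σ hσ
  refine ⟨τ, hτ, fun x hx y hy hxy p p' hp hp' hpp => ?_⟩
  have := h (x, p) ⟨hx, by simpa using hp⟩ (y, p') ⟨hy, by simpa using hp'⟩ (by
    rw [Prod.dist_eq, max_lt_iff, dist_eq_norm, dist_eq_norm]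
    exact ⟨hxy, hpp⟩)
  rw [Real.dist_eq] at this
  linarith [(abs_lt.1 this).2]

/-- Convexity propagates coercivity from one point to its neighbours. Near `z`, `H x` exceeds both
`s` and `H x 0` on the sphere of radius `R`, by uniform continuity on a compact set, and a convex
function that has risen along a ray cannot fall back further out. -/
theorem exists_coercive (hP : IsNeumannProblem Ω H γ g) (hz : z ∈ closure Ω) (s : ℝ) :
    ∃ R > 0, ∃ r > 0, ∀ x ∈ closure Ω, x ∈ Metric.ball z r → ∀ p, R ≤ ‖p‖ → s < H x p := by
  set T : ℝ := max s (H z 0) + 2 with hT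
  have h1 := (hP.coercive z hz).eventually_ge_atTop T
  rw [← comap_norm_atTop, eventually_comap] at h1
  obtain ⟨R₀, hR₀⟩ := eventually_atTop.1 h1
  set R := max R₀ 1
  have hRpos : 0 < R := lt_max_of_lt_right one_pos
  obtain ⟨τ, hτ, hH⟩ := hP.exists_uniform_H R one_pos
  refine ⟨R, hRpos, τ, hτ, fun x hx hxz p hp => ?_⟩
  rw [Metric.mem_ball, dist_eq_norm] at hxz
  have hzx : ‖z - x‖ < τ := by rwa [norm_sub_rev]
  have hp0 : 0 < ‖p‖ := hRpos.trans_le hp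
  set t := R / ‖p‖ with ht
  have ht0 : 0 < t := div_pos hRpos hp0
  have ht1 : t ≤ 1 := (div_le_one hp0).2 hp
  have hnorm : ‖t • p‖ = R := by
    rw [norm_smul, Real.norm_of_nonneg ht0.le, ht, div_mul_cancel₀ _ hp0.ne']
  have e1 : T ≤ H z (t • p) := hR₀ R (le_max_left _ _) _ hnorm
  have e2 := hH z hz x hx hzx (t • p) (t • p) hnorm.le hnorm.le (by simpa using hτ)
  have e3 := hH x hx z hz hxz 0 0 (by simpa using hRpos.le) (by simpa using hRpos.le)
    (by simpa using hτ)
  have e4 := (hP.convexOn x hx).2 (mem_univ 0) (mem_univ p) (sub_nonneg.2 ht1) ht0.le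
    (sub_add_cancel 1 t)
  rw [smul_zero, zero_add, smul_eq_mul, smul_eq_mul] at e4
  have hs := le_max_left s (H z 0)
  have hs' := le_max_right s (H z 0)
  by_contra hcon
  push Not at hcon
  nlinarith

set_option maxHeartbeats 1000000 in
/-- Subsolutions are locally Lipschitz continuous up to the boundary, uniformly. -/
theorem exists_lipschitz (hP : IsNeumannProblem Ω H γ g) (hz : z ∈ closure Ω) :
    ∃ r > 0, ∃ L ≥ 0, ∀ u : EuclideanSpace ℝ (Fin n) → ℝ,
      UpperSemicontinuousOn u (closure Ω) → SubOn Ω H γ g univ 0 u →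
      ∀ x ∈ closure Ω, x ∈ Metric.ball z r → ∀ y ∈ closure Ω, y ∈ Metric.ball z r →
        u x ≤ u y + L * ‖x - y‖ := by
  obtain ⟨A, c, q, G, hc, hAsym, hAc, hfr⟩ := hP.exists_oblique_form hz
  obtain ⟨R, hR, r₁, hr₁, hco⟩ := hP.exists_coercive hz 0
  have hsc : 0 < √c := Real.sqrt_pos.2 hc
  -- The linear tilt `θ q` is small enough that `s` below stays comparable to the distance from `y`,
  -- and `κ` is small enough that the tilt dominates the boundary error.
  set θ : ℝ := √c / (2 * (‖q‖ + 1)) with hθ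
  have hθ0 : 0 < θ := by positivity
  have hθq : θ * ‖q‖ ≤ √c / 2 := by
    rw [hθ, div_mul_eq_mul_div, div_le_div_iff₀ (by positivity) two_pos]
    nlinarith [norm_nonneg q]
  set κ : ℝ := min (1 / 2) (θ * √c / 4) with hκ
  have hκ0 : 0 < κ := lt_min (by norm_num) (by positivity)
  obtain ⟨r₂, hr₂, hfr⟩ := hfr κ hκ0
  set r₀ := min r₁ r₂ with hr₀
  have hr₀0 : 0 < r₀ := lt_min hr₁ hr₂
  set c' : ℝ := √c / 2 with hc'
  have hc'0 : 0 < c' := by positivity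
  set ρ : ℝ := c' * (r₀ / 2) with hρ
  have hρ0 : 0 < ρ := by positivity
  set g₀ : ℝ := |g z| + 1 with hg₀
  have hg₀0 : 0 < g₀ := by positivity
  -- A slope `k` makes the barrier too steep for either alternative: the first summand defeats `H ≤
  -- 0`, the second the boundary inequality. As `L = ρ ^ 2 * k`, the factor `L / (ρ - s) ^ 2` is at
  -- least `k`.
  set k : ℝ := R / c' + 4 * (g₀ + 1) / θ with hk
  have hk0 : 0 < k := by positivity
  set L : ℝ := ρ ^ 2 * k with hL
  have hL0 : 0 < L := by positivity
  set Cs : ℝ := √‖A‖ + θ * ‖q‖ + 1 with hCs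
  have hCs0 : 0 < Cs := by positivity
  refine ⟨min (r₀ / 2) (ρ / (4 * Cs)), by positivity, 2 * L * Cs / ρ ^ 2, by positivity,
    fun u hu hsub x₁ hx₁ hx₁r y hy hyr => ?_⟩
  have hyr₀ : ‖y - z‖ < r₀ / 2 := by
    rw [← dist_eq_norm]; exact lt_of_lt_of_le hyr (min_le_left _ _)
  set N : EuclideanSpace ℝ (Fin n) → ℝ := fun x => √(inner ℝ (A (x - y)) (x - y)) with hN
  have hNlow : ∀ x, √c * ‖x - y‖ ≤ N x := by
    intro x
    refine Real.le_sqrt_of_sq_le ?_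
    rw [mul_pow, Real.sq_sqrt hc.le]
    exact hAc _
  set s : EuclideanSpace ℝ (Fin n) → ℝ := fun x => N x + θ * inner ℝ q (x - y) with hs
  have hin : ∀ x, |θ * (inner ℝ q (x - y) : ℝ)| ≤ θ * ‖q‖ * ‖x - y‖ := by
    intro x
    rw [abs_mul, abs_of_pos hθ0, mul_assoc]
    exact mul_le_mul_of_nonneg_left (abs_real_inner_le_norm _ _) hθ0.le
  have hslow : ∀ x, c' * ‖x - y‖ ≤ s x := by
    intro x
    have h1 := hNlow x
    have h2 := neg_le_of_abs_le (hin x)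
    have h3 := mul_le_mul_of_nonneg_right hθq (norm_nonneg (x - y))
    rw [hc'] at h3 ⊢
    simp only [hs]
    linarith
  have hs0 : ∀ x, 0 ≤ s x := fun x => le_trans (by positivity) (hslow x)
  have hsup : ∀ x, s x ≤ Cs * ‖x - y‖ := by
    intro x
    have h1 : N x ≤ √‖A‖ * ‖x - y‖ := by
      refine Real.sqrt_le_iff.2 ⟨by positivity, ?_⟩
      rw [mul_pow, Real.sq_sqrt (norm_nonneg _), sq, ← mul_assoc]
      refine (real_inner_le_norm _ _).trans ?_
      exact mul_le_mul_of_nonneg_right (A.le_opNorm _) (norm_nonneg _)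
    have h2 := le_of_abs_le (hin x)
    simp only [hs, hCs]
    nlinarith [norm_nonneg (x - y)]
  have hsy : s y = 0 := le_antisymm (by simpa using hsup y) (hs0 y)
  have hscont : Continuous s := by
    simp only [hs, hN]
    fun_prop
  obtain ⟨B, hB⟩ := hu.bddAbove_of_isCompact hP.isCompact_closure
  -- The barrier `L / (ρ - s)` blows up at `s = ρ`. The level `t` is so close to `ρ` that a maximum
  -- of `u` minus the barrier on `{s ≤ t}` cannot lie on `{s = t}`. Only `t` depends on `u`; it does
  -- not enter the final constant.
  set T : ℝ := |B - u y| + L / ρ + 1 with hT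
  have hT0 : 0 < T := by positivity
  set t : ℝ := ρ - min (L / T) (ρ / 2) with ht
  have htρ : t < ρ := by
    have : 0 < min (L / T) (ρ / 2) := lt_min (by positivity) (by positivity)
    linarith
  have hthalf : ρ / 2 ≤ t := by linarith [min_le_right (L / T) (ρ / 2)]
  have htT : T ≤ L / (ρ - t) := by
    rw [le_div_iff₀ (by linarith), ← le_div_iff₀' hT0]
    linarith [min_le_left (L / T) (ρ / 2)]
  set K : Set (EuclideanSpace ℝ (Fin n)) := closure Ω ∩ {x | s x ≤ t} with hK
  have hKc : IsCompact K :=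
    hP.isCompact_closure.inter_right (isClosed_le hscont continuous_const)
  have hyK : y ∈ K := ⟨hy, by simp only [mem_ofPred_eq, hsy]; linarith⟩
  have husc : UpperSemicontinuousOn (fun x => u x + -(L / (ρ - s x))) K := by
    refine (hu.mono inter_subset_left).add (ContinuousOn.upperSemicontinuousOn ?_)
    refine (continuousOn_const.div (by fun_prop) fun x hx => ?_).neg
    have : s x ≤ t := hx.2
    linarith
  obtain ⟨x, hxK, hxmax⟩ := husc.exists_isMaxOn ⟨y, hyK⟩ hKc
  have hxt : s x ≤ t := hxK.2
  have hmaxy : u y + -(L / ρ) ≤ u x + -(L / (ρ - s x)) := by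
    have := hxmax hyK
    simpa only [mem_ofPred_eq, hsy, sub_zero] using this
  have hxlt : s x < t := by
    refine lt_of_le_of_ne hxt fun heq => ?_
    rw [heq] at hmaxy
    have h1 : u x ≤ B := hB ⟨x, hxK.1, rfl⟩
    linarith [le_abs_self (B - u y)]
  have hlocmax : IsLocalMaxOn (fun w => u w - L / (ρ - s w)) (closure Ω) x := by
    have hev : ∀ᶠ w in 𝓝 x, s w < t := hscont.continuousAt.eventually_lt_const hxlt
    filter_upwards [self_mem_nhdsWithin, mem_nhdsWithin_of_mem_nhds hev] with w hw hwt
    have := hxmax (show w ∈ K from ⟨hw, le_of_lt hwt⟩)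
    simpa only [mem_ofPred_eq, ← sub_eq_add_neg] using this
  -- Away from its vertex the barrier is a strict supersolution, so the maximum can only sit at `y`;
  -- this yields the estimate.
  have hxy : x = y := by
    by_contra hne
    have hnorm : 0 < ‖x - y‖ := norm_pos_iff.2 (sub_ne_zero.2 hne)
    have hNpos : 0 < N x := lt_of_lt_of_le (by positivity) (hNlow x)
    have hQpos : 0 < (inner ℝ (A (x - y)) (x - y) : ℝ) := Real.sqrt_pos.1 hNpos
    have hρs : 0 < ρ - s x := by linarith
    set Ds : EuclideanSpace ℝ (Fin n) :=
      (1 / (2 * N x)) • ((2 : ℝ) • A (x - y)) + θ • q with hDs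
    have hgrads : HasGradientAt s Ds x := by
      have h1 := HasGradientAt.comp_real (h := Real.sqrt)
        (f₁ := fun x => (inner ℝ (A (x - y)) (x - y) : ℝ)) (Real.hasDerivAt_sqrt hQpos.ne')
        (hasGradientAt_quadratic (x := x) A hAsym y)
      exact h1.fun_add ((hasGradientAt_inner_left q y).fun_const_mul θ)
    have hgradφ : HasGradientAt (fun w => L / (ρ - s w)) ((L / (ρ - s x) ^ 2) • Ds) x := by
      refine HasGradientAt.comp_real (h := fun σ => L / (ρ - σ)) ?_ hgrads
      have h1 : HasDerivAt (fun σ => ρ - σ) (-1) (s x) := by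
        simpa using (hasDerivAt_id (s x)).const_sub ρ
      have h2 := (hasDerivAt_const (s x) L).div h1 hρs.ne'
      refine h2.congr_deriv ?_
      ring
    have hsC : ContDiffAt ℝ 1 s x := by
      simp only [hs, hN]
      refine ContDiffAt.add (ContDiffAt.sqrt ?_ hQpos.ne') ?_
      · exact ContDiffAt.inner ℝ (A.contDiff.contDiffAt.comp x (contDiffAt_id.sub contDiffAt_const))
          (contDiffAt_id.sub contDiffAt_const)
      · exact contDiffAt_const.mul
          (ContDiffAt.inner ℝ contDiffAt_const (contDiffAt_id.sub contDiffAt_const))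
    have hφC : ContDiffAt ℝ 1 (fun w => L / (ρ - s w)) x :=
      contDiffAt_const.div (contDiffAt_const.sub hsC) hρs.ne'
    have hkey := hsub x hxK.1 (mem_univ _) _ _ hφC hgradφ hlocmax
    have hxz : x ∈ Metric.ball z r₀ := by
      rw [Metric.mem_ball, dist_eq_norm]
      have h1 := (hslow x).trans_lt (hxlt.trans htρ)
      have h2 : ‖x - y‖ < r₀ / 2 := lt_of_mul_lt_mul_left h1 hc'0.le
      have h3 := norm_sub_le_norm_sub_add_norm_sub x y z
      linarith
    have hk' : k ≤ L / (ρ - s x) ^ 2 := by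
      rw [le_div_iff₀ (by positivity), hL, mul_comm]
      refine mul_le_mul_of_nonneg_right ?_ hk0.le
      exact pow_le_pow_left₀ hρs.le (by linarith [hs0 x]) 2
    -- Euler's identity: `s` is positively homogeneous of degree one about `y`. It bounds the norm
    -- of the gradient from below.
    have hDsin : (inner ℝ Ds (x - y) : ℝ) = s x := by
      simp only [hDs, inner_add_left, real_inner_smul_left, hs]
      have : (inner ℝ (A (x - y)) (x - y) : ℝ) = N x ^ 2 := (Real.sq_sqrt hQpos.le).symm
      rw [this]
      field_simp
    have hDsn : c' ≤ ‖Ds‖ := by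
      have h1 := real_inner_le_norm Ds (x - y)
      rw [hDsin] at h1
      exact le_of_mul_le_mul_right ((hslow x).trans h1) hnorm
    rcases hkey with hkey | ⟨hxΓ, hkey⟩
    · have hbig : R ≤ ‖(L / (ρ - s x) ^ 2) • Ds‖ := by
        rw [norm_smul, Real.norm_of_nonneg (by positivity)]
        have h1 : R / c' ≤ k := by
          have : 0 ≤ 4 * (g₀ + 1) / θ := by positivity
          linarith
        calc R = R / c' * c' := by field_simp
          _ ≤ _ := mul_le_mul (h1.trans hk') hDsn hc'0.le (by positivity)
      have := hco x hxK.1 (Metric.ball_subset_ball (min_le_left _ _) hxz) _ hbig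
      linarith
    · have hb2 := Metric.ball_subset_ball (min_le_right r₁ r₂) hxz
      obtain ⟨-, hq1, hg1, hA1⟩ := hfr x hxΓ hb2
      have hyb : y ∈ Metric.ball z r₂ := by
        rw [Metric.mem_ball, dist_eq_norm]
        have : r₀ ≤ r₂ := min_le_right _ _
        linarith
      have hA2 := hA1 y hy hyb
      -- The form `A` costs at most `θ / 4`, while the tilt contributes at least `θ / 2`.
      have hγDs : θ / 4 ≤ inner ℝ (γ x) Ds := by
        have e : (inner ℝ (γ x) Ds : ℝ)
            = (N x)⁻¹ * inner ℝ (γ x) (A (x - y)) + θ * inner ℝ (γ x) q := by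
          simp only [hDs, inner_add_right, real_inner_smul_right]
          field_simp
        have h1 : κ * ‖x - y‖ ≤ θ / 4 * N x := by
          calc κ * ‖x - y‖ ≤ θ * √c / 4 * ‖x - y‖ :=
                mul_le_mul_of_nonneg_right (min_le_right _ _) hnorm.le
            _ = θ / 4 * (√c * ‖x - y‖) := by ring
            _ ≤ _ := mul_le_mul_of_nonneg_left (hNlow x) (by positivity)
        have h2 : -(θ / 4) ≤ (N x)⁻¹ * inner ℝ (γ x) (A (x - y)) := by
          rw [inv_mul_eq_div, le_div_iff₀ hNpos]
          linarith
        have h3 : 1 / 2 ≤ (inner ℝ (γ x) q : ℝ) := by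
          have := (abs_le.1 hq1).1
          have := min_le_left (1 / 2 : ℝ) (θ * √c / 4)
          linarith
        rw [e]
        nlinarith
      rw [real_inner_smul_right] at hkey
      have h1 : 4 * (g₀ + 1) / θ ≤ k := by
        have : 0 ≤ R / c' := by positivity
        linarith
      have h2 : g₀ + 1 ≤ L / (ρ - s x) ^ 2 * inner ℝ (γ x) Ds := by
        calc g₀ + 1 = 4 * (g₀ + 1) / θ * (θ / 4) := by field_simp
          _ ≤ _ := mul_le_mul (h1.trans hk') hγDs (by positivity) (by positivity)
      have h3 : g x ≤ g₀ := by
        have h4 := (abs_le.1 hg1).2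
        have h5 := min_le_left (1 / 2 : ℝ) (θ * √c / 4)
        have h6 := le_abs_self (g z)
        linarith
      linarith
  have hdist : ‖x₁ - y‖ < ρ / (2 * Cs) := by
    have h1 : ‖x₁ - z‖ < ρ / (4 * Cs) := by
      rw [← dist_eq_norm]; exact lt_of_lt_of_le hx₁r (min_le_right _ _)
    have h2 : ‖z - y‖ < ρ / (4 * Cs) := by
      rw [← dist_eq_norm, dist_comm]; exact lt_of_lt_of_le hyr (min_le_right _ _)
    have h3 := norm_sub_le_norm_sub_add_norm_sub x₁ z y
    have h4 : ρ / (2 * Cs) = ρ / (4 * Cs) + ρ / (4 * Cs) := by field_simp; norm_num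
    linarith
  have hs1 : s x₁ ≤ ρ / 2 := by
    have h1 := mul_le_mul_of_nonneg_left hdist.le hCs0.le
    have h2 : Cs * (ρ / (2 * Cs)) = ρ / 2 := by field_simp
    linarith [hsup x₁]
  have hfin := hxmax (show x₁ ∈ K from ⟨hx₁, hs1.trans hthalf⟩)
  simp only [mem_ofPred_eq, hxy, hsy, sub_zero] at hfin
  have hρs1 : 0 < ρ - s x₁ := by linarith
  have hdiff : L / (ρ - s x₁) - L / ρ ≤ 2 * L * Cs / ρ ^ 2 * ‖x₁ - y‖ := by
    have e : L / (ρ - s x₁) - L / ρ = L * s x₁ / (ρ * (ρ - s x₁)) := by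
      field_simp; ring
    rw [e, div_mul_eq_mul_div, div_le_div_iff₀ (by positivity) (by positivity)]
    have h1 := hsup x₁
    have h2 : ρ ^ 2 ≤ 2 * (ρ * (ρ - s x₁)) := by nlinarith
    calc L * s x₁ * ρ ^ 2 ≤ L * s x₁ * (2 * (ρ * (ρ - s x₁))) :=
          mul_le_mul_of_nonneg_left h2 (mul_nonneg hL0.le (hs0 _))
      _ ≤ L * (Cs * ‖x₁ - y‖) * (2 * (ρ * (ρ - s x₁))) := by gcongr
      _ = _ := by ring
  linarith

end IsNeumannProblem

/-! ### The penalty function. -/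

section Penalty

variable {E : Type*} [NormedAddCommGroup E] [InnerProductSpace ℝ E]
  {A : E →L[ℝ] E} {c ε : ℝ}

/-- If the penalty `⟨Aξ, ξ⟩ / 2ε + ⟨b, ξ⟩` is at most `L‖ξ‖` then `ξ` is of order `ε`. -/
theorem norm_le_of_penalty_le (hc : 0 < c) (hA : ∀ ξ, c * ‖ξ‖ ^ 2 ≤ inner ℝ (A ξ) ξ) (hε : 0 < ε)
    {b ξ : E} {L B : ℝ} (hL : 0 ≤ L) (hb : ‖b‖ ≤ B)
    (h : (2 * ε)⁻¹ * (inner ℝ (A ξ) ξ : ℝ) + inner ℝ b ξ ≤ L * ‖ξ‖) :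
    ‖ξ‖ ≤ 2 * (L + B) / c * ε := by
  have h1 := neg_le_of_abs_le (abs_real_inner_le_norm b ξ)
  have h2 : ‖b‖ * ‖ξ‖ ≤ B * ‖ξ‖ := mul_le_mul_of_nonneg_right hb (norm_nonneg _)
  have h3 : (2 * ε)⁻¹ * (c * ‖ξ‖ ^ 2) ≤ (L + B) * ‖ξ‖ := by
    have := mul_le_mul_of_nonneg_left (hA ξ) (show (0 : ℝ) ≤ (2 * ε)⁻¹ by positivity)
    linarith
  rw [inv_mul_le_iff₀ (by positivity)] at h3
  have hB : 0 ≤ B := (norm_nonneg b).trans hb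
  rcases (norm_nonneg ξ).eq_or_lt with h0 | h0
  · rw [← h0]; positivity
  · rw [div_mul_eq_mul_div, le_div_iff₀ hc]
    nlinarith

theorem hasGradientAt_penalty [CompleteSpace E]
    (hA : ∀ ξ η, (inner ℝ (A ξ) η : ℝ) = inner ℝ ξ (A η)) (hε : ε ≠ 0)
    (b x y : E) :
    HasGradientAt (fun x => (2 * ε)⁻¹ * (inner ℝ (A (x - y)) (x - y) : ℝ) + inner ℝ b (x - y))
      (ε⁻¹ • A (x - y) + b) x := by
  have h := ((hasGradientAt_quadratic (x := x) A hA y).fun_const_mul (2 * ε)⁻¹).fun_add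
    (hasGradientAt_inner_left b y)
  convert h using 2
  rw [smul_smul]
  congr 1
  field_simp

theorem hasGradientAt_penalty_right [CompleteSpace E]
    (hA : ∀ ξ η, (inner ℝ (A ξ) η : ℝ) = inner ℝ ξ (A η))
    (hε : ε ≠ 0) (b x y : E) :
    HasGradientAt (fun y => (2 * ε)⁻¹ * (inner ℝ (A (x - y)) (x - y) : ℝ) + inner ℝ b (x - y))
      (-(ε⁻¹ • A (x - y) + b)) y := by
  have h := hasGradientAt_penalty hA hε (-b) y x
  convert h using 1
  · ext w
    rw [← neg_sub w x, map_neg, inner_neg_neg, inner_neg_right, inner_neg_left]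
  · rw [← neg_sub y x, map_neg, smul_neg, neg_add, neg_neg]

theorem contDiff_penalty (b y : E) :
    ContDiff ℝ 1
      (fun x => (2 * ε)⁻¹ * (inner ℝ (A (x - y)) (x - y) : ℝ) + inner ℝ b (x - y)) := by
  refine (contDiff_const.mul (ContDiff.inner ℝ ?_ ?_)).add (ContDiff.inner ℝ contDiff_const ?_)
  · exact A.contDiff.comp (contDiff_id.sub contDiff_const)
  · exact contDiff_id.sub contDiff_const
  · exact contDiff_id.sub contDiff_const

theorem contDiff_penalty_right (b x : E) :
    ContDiff ℝ 1
      (fun y => (2 * ε)⁻¹ * (inner ℝ (A (x - y)) (x - y) : ℝ) + inner ℝ b (x - y)) := by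
  refine (contDiff_const.mul (ContDiff.inner ℝ ?_ ?_)).add (ContDiff.inner ℝ contDiff_const ?_)
  · exact A.contDiff.comp (contDiff_const.sub contDiff_id)
  · exact contDiff_const.sub contDiff_id
  · exact contDiff_const.sub contDiff_id

end Penalty

theorem continuousOn_of_le_add_mul_norm {E : Type*} [NormedAddCommGroup E] {D : Set E} {u : E → ℝ}
    {L : ℝ} (hL : 0 ≤ L) (h : ∀ x ∈ D, ∀ y ∈ D, u x ≤ u y + L * ‖x - y‖) : ContinuousOn u D := by
  have : LipschitzOnWith L.toNNReal u D :=
    LipschitzOnWith.of_le_add_mul _ fun x hx y hy => by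
      rw [Real.coe_toNNReal L hL, dist_eq_norm]
      exact h x hx y hy
  exact this.continuousOn

/-! ### Local comparison by doubling of variables. -/

namespace IsNeumannProblem

variable {n : ℕ} {Ω : Set (EuclideanSpace ℝ (Fin n))}
  {H : EuclideanSpace ℝ (Fin n) → EuclideanSpace ℝ (Fin n) → ℝ}
  {γ : EuclideanSpace ℝ (Fin n) → EuclideanSpace ℝ (Fin n)}
  {g : EuclideanSpace ℝ (Fin n) → ℝ} {z : EuclideanSpace ℝ (Fin n)}

set_option maxHeartbeats 2000000 in
/-- The comparison principle in local form: a convex combination of subsolutions minus a strictly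
larger supersolution has no local maximum. The variables of both subsolutions and of the
supersolution are doubled. -/
theorem not_isLocalMaxOn (hP : IsNeumannProblem Ω H γ g) (hz : z ∈ closure Ω)
    {u ψ v : EuclideanSpace ℝ (Fin n) → ℝ} {r₀ L s₁ s₂ s₃ m₁ m₂ : ℝ} (hr₀ : 0 < r₀) (hL : 0 ≤ L)
    (hu : ∀ x ∈ closure Ω ∩ Metric.ball z r₀, ∀ y ∈ closure Ω ∩ Metric.ball z r₀,
      u x ≤ u y + L * ‖x - y‖)
    (hψ : ∀ x ∈ closure Ω ∩ Metric.ball z r₀, ∀ y ∈ closure Ω ∩ Metric.ball z r₀,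
      ψ x ≤ ψ y + L * ‖x - y‖)
    (hv : LowerSemicontinuousOn v (closure Ω ∩ Metric.ball z r₀))
    (hus : SubOn Ω H γ g (Metric.ball z r₀) s₁ u)
    (hψs : SubOn Ω H γ g (Metric.ball z r₀) s₂ ψ)
    (hvs : SuperOn Ω H γ g (Metric.ball z r₀) s₃ v)
    (hm₁ : 0 < m₁) (hm₂ : 0 < m₂) (hm : m₁ + m₂ = 1) (hs : m₁ * s₁ + m₂ * s₂ < s₃)
    (hmax : IsLocalMaxOn (fun y => m₁ * u y + m₂ * ψ y - v y) (closure Ω) z) : False := by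
  obtain ⟨A, c, q, G, hc, hAsym, hAc, hfr⟩ := hP.exists_oblique_form hz
  set σ : ℝ := s₃ - (m₁ * s₁ + m₂ * s₂) with hσ
  have hσ0 : 0 < σ := sub_pos.2 hs
  -- Each linear term aims the `γ`-derivative at `σ / 4` above the boundary level of its
  -- subsolution. The convex combination then still falls well short of the supersolution's level,
  -- which is higher by `σ`.
  set k₁ : ℝ := g z + s₁ + σ / 4 with hk₁
  set k₂ : ℝ := g z + s₂ + σ / 4 with hk₂
  set b₁ := k₁ • q with hb₁
  set b₂ := k₂ • q with hb₂
  set B : ℝ := ‖b₁‖ + ‖b₂‖ with hB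
  have hB1 : ‖b₁‖ ≤ B := le_add_of_nonneg_right (norm_nonneg _)
  have hB2 : ‖b₂‖ ≤ B := le_add_of_nonneg_left (norm_nonneg _)
  have hB0 : 0 ≤ B := (norm_nonneg _).trans hB1
  set C : ℝ := 2 * (L + B) / c with hC
  have hC0 : 0 ≤ C := by positivity
  set P₀ : ℝ := ‖A‖ * C + B with hP₀
  set Kk : ℝ := |k₁| + |k₂| with hKk
  have hKk1 : |k₁| ≤ Kk := le_add_of_nonneg_right (abs_nonneg _)
  have hKk2 : |k₂| ≤ Kk := le_add_of_nonneg_left (abs_nonneg _)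
  -- The bounds `C` and `P₀` do not involve `ε`, so the parameters can be chosen in the order `κ`,
  -- `r`, `ε`. All geometric errors together cost at most `σ / 8`.
  set κ : ℝ := σ / (8 * (C + Kk + 1)) with hκ
  have hden : 0 < C + Kk + 1 := by positivity
  have hκ0 : 0 < κ := by positivity
  have hκσ : κ * C + κ * Kk + κ = σ / 8 := by
    rw [hκ]; field_simp
  obtain ⟨r₁, hr₁, hfr⟩ := hfr κ hκ0
  obtain ⟨τ, hτ, hH⟩ := hP.exists_uniform_H (P₀ + 2) (σ := σ / 4) (by positivity)
  obtain ⟨r₂, hr₂, hloc⟩ := Metric.eventually_nhds_iff_ball.1 (eventually_nhdsWithin_iff.1 hmax)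
  obtain ⟨r, hr, hrr₀, hrr₁, hrr₂, hrτ, hr1, hrG⟩ : ∃ r > 0, r < r₀ ∧ r < r₁ ∧ r < r₂ ∧
      2 * r < τ ∧ 2 * r ≤ 2 ∧ 2 * r * |G| ≤ σ / 8 := by
    set r' := min r₀ (min r₁ (min r₂ (min (τ / 2) (min 2 (σ / (8 * (|G| + 1))))))) with hr'
    have hr'0 : 0 < r' := by positivity
    have i1 : r' ≤ r₀ := min_le_left _ _
    have i2 : r' ≤ r₁ := (min_le_right _ _).trans (min_le_left _ _)
    have i3 : r' ≤ r₂ := (min_le_right _ _).trans ((min_le_right _ _).trans (min_le_left _ _))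
    have i0 : r' ≤ min (τ / 2) (min 2 (σ / (8 * (|G| + 1)))) :=
      (min_le_right _ _).trans ((min_le_right _ _).trans (min_le_right _ _))
    have i4 : r' ≤ τ / 2 := i0.trans (min_le_left _ _)
    have i5 : r' ≤ 2 := i0.trans ((min_le_right _ _).trans (min_le_left _ _))
    have i6 : r' ≤ σ / (8 * (|G| + 1)) := i0.trans ((min_le_right _ _).trans (min_le_right _ _))
    refine ⟨r' / 2, by positivity, by linarith, by linarith, by linarith, by linarith, by linarith,
      ?_⟩
    rw [le_div_iff₀ (by positivity)] at i6
    nlinarith [abs_nonneg G]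
  -- The first bound keeps `x` and `x'` within `r / 2` of `y`; the second keeps `y` within `r / 2`
  -- of `z`, so no maximizer reaches the boundary of the ball.
  set ε : ℝ := min (r / (4 * (C + 1))) (r ^ 2 / (8 * ((L + B) * C + 1))) with hε
  have hε0 : 0 < ε := by positivity
  have hCε : C * ε < r / 2 := by
    have h1 : ε ≤ r / (4 * (C + 1)) := min_le_left _ _
    rw [le_div_iff₀ (by positivity)] at h1
    nlinarith
  have hLCε : (L + B) * (C * ε) < (r / 2) ^ 2 := by
    have h1 : ε ≤ r ^ 2 / (8 * ((L + B) * C + 1)) := min_le_right _ _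
    rw [le_div_iff₀ (by positivity)] at h1
    nlinarith [pow_pos hr 2]
  set f₁ : EuclideanSpace ℝ (Fin n) → ℝ :=
    fun ξ => (2 * ε)⁻¹ * (inner ℝ (A ξ) ξ : ℝ) + inner ℝ b₁ ξ with hf₁
  set f₂ : EuclideanSpace ℝ (Fin n) → ℝ :=
    fun ξ => (2 * ε)⁻¹ * (inner ℝ (A ξ) ξ : ℝ) + inner ℝ b₂ ξ with hf₂
  have hf₁0 : f₁ 0 = 0 := by simp [hf₁]
  have hf₂0 : f₂ 0 = 0 := by simp [hf₂]
  have hf₁c : Continuous f₁ := by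
    simp only [hf₁]
    exact (continuous_const.mul (A.continuous.inner continuous_id)).add
      (continuous_const.inner continuous_id)
  have hf₂c : Continuous f₂ := by
    simp only [hf₂]
    exact (continuous_const.mul (A.continuous.inner continuous_id)).add
      (continuous_const.inner continuous_id)
  have hlow : ∀ {b ξ : EuclideanSpace ℝ (Fin n)}, ‖b‖ ≤ B →
      -(B * ‖ξ‖) ≤ (2 * ε)⁻¹ * (inner ℝ (A ξ) ξ : ℝ) + inner ℝ b ξ := by
    intro b ξ hb
    have h1 := neg_le_of_abs_le (abs_real_inner_le_norm b ξ)
    have h2 := mul_le_mul_of_nonneg_right hb (norm_nonneg ξ)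
    have h3 : 0 ≤ (2 * ε)⁻¹ * (inner ℝ (A ξ) ξ : ℝ) :=
      mul_nonneg (by positivity) (le_trans (by positivity) (hAc ξ))
    linarith
  set D : Set (EuclideanSpace ℝ (Fin n)) := closure Ω ∩ Metric.closedBall z r with hD
  have hDc : IsCompact D := hP.isCompact_closure.inter_right Metric.isClosed_closedBall
  have hzD : z ∈ D := ⟨hz, Metric.mem_closedBall_self hr.le⟩
  have hDsub : D ⊆ closure Ω ∩ Metric.ball z r₀ :=
    inter_subset_inter_right _ (Metric.closedBall_subset_ball hrr₀)
  have huc : ContinuousOn u D := (continuousOn_of_le_add_mul_norm hL hu).mono hDsub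
  have hψc : ContinuousOn ψ D := (continuousOn_of_le_add_mul_norm hL hψ).mono hDsub
  -- Each subsolution has its own variable, both coupled to that of `v`; the term `‖y - z‖ ^ 2`
  -- localizes near `z`.
  set F : EuclideanSpace ℝ (Fin n) × EuclideanSpace ℝ (Fin n) × EuclideanSpace ℝ (Fin n) → ℝ :=
    fun w => (m₁ * (u w.1 - f₁ (w.1 - w.2.2)) + m₂ * (ψ w.2.1 - f₂ (w.2.1 - w.2.2))
      - ‖w.2.2 - z‖ ^ 2) + (-v ∘ fun w => w.2.2) w with hF
  have hFusc : UpperSemicontinuousOn F (D ×ˢ D ×ˢ D) := by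
    refine UpperSemicontinuousOn.add (ContinuousOn.upperSemicontinuousOn ?_) ?_
    · have e1 : ContinuousOn (fun w : EuclideanSpace ℝ (Fin n) × EuclideanSpace ℝ (Fin n) ×
          EuclideanSpace ℝ (Fin n) => u w.1) (D ×ˢ D ×ˢ D) :=
        huc.comp continuousOn_fst fun w hw => hw.1
      have e2 : ContinuousOn (fun w : EuclideanSpace ℝ (Fin n) × EuclideanSpace ℝ (Fin n) ×
          EuclideanSpace ℝ (Fin n) => ψ w.2.1) (D ×ˢ D ×ˢ D) :=
        hψc.comp (f := fun w : EuclideanSpace ℝ (Fin n) × EuclideanSpace ℝ (Fin n) ×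
          EuclideanSpace ℝ (Fin n) => w.2.1) (by fun_prop) fun w hw => hw.2.1
      have e3 : Continuous (fun w : EuclideanSpace ℝ (Fin n) × EuclideanSpace ℝ (Fin n) ×
          EuclideanSpace ℝ (Fin n) => f₁ (w.1 - w.2.2)) := hf₁c.comp (by fun_prop)
      have e4 : Continuous (fun w : EuclideanSpace ℝ (Fin n) × EuclideanSpace ℝ (Fin n) ×
          EuclideanSpace ℝ (Fin n) => f₂ (w.2.1 - w.2.2)) := hf₂c.comp (by fun_prop)
      exact ((continuousOn_const.mul (e1.sub e3.continuousOn)).add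
        (continuousOn_const.mul (e2.sub e4.continuousOn))).sub
        (Continuous.continuousOn (by fun_prop))
    · exact (hv.neg.mono hDsub).comp (Continuous.continuousOn (by fun_prop)) fun w hw => hw.2.2
  have hne : (D ×ˢ D ×ˢ D).Nonempty := ⟨(z, z, z), hzD, hzD, hzD⟩
  obtain ⟨⟨x, x', y⟩, ⟨hxD, hx'D, hyD⟩, hFmax⟩ :=
    hFusc.exists_isMaxOn hne (hDc.prod (hDc.prod hDc))
  have hFm : ∀ a ∈ D, ∀ a' ∈ D, ∀ b ∈ D,
      m₁ * (u a - f₁ (a - b)) + m₂ * (ψ a' - f₂ (a' - b)) - ‖b - z‖ ^ 2 - v b ≤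
      m₁ * (u x - f₁ (x - y)) + m₂ * (ψ x' - f₂ (x' - y)) - ‖y - z‖ ^ 2 - v y := by
    intro a ha a' ha' b hb
    have := hFmax (show (a, a', b) ∈ D ×ˢ D ×ˢ D from ⟨ha, ha', hb⟩)
    simpa only [mem_ofPred_eq, hF, Function.comp_apply, Pi.neg_apply, ← sub_eq_add_neg] using this
  simp only at hxD hx'D hyD
  have hu1 : u x ≤ u y + L * ‖x - y‖ := hu x (hDsub hxD) y (hDsub hyD)
  have hψ1 : ψ x' ≤ ψ y + L * ‖x' - y‖ := hψ x' (hDsub hx'D) y (hDsub hyD)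
  -- Moving `x` to `y` cannot increase the functional, so the penalty is at most the Lipschitz
  -- variation of `u`.
  have hxy : ‖x - y‖ ≤ C * ε := by
    have h1 := hFm y hyD x' hx'D y hyD
    rw [sub_self, hf₁0, sub_zero] at h1
    have h2 : m₁ * u y ≤ m₁ * (u x - f₁ (x - y)) := by linarith
    have h3 := le_of_mul_le_mul_left h2 hm₁
    exact norm_le_of_penalty_le hc hAc hε0 hL hB1 (show f₁ (x - y) ≤ _ by linarith)
  have hx'y : ‖x' - y‖ ≤ C * ε := by
    have h1 := hFm x hxD y hyD y hyD
    rw [sub_self, hf₂0, sub_zero] at h1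
    have h2 : m₂ * ψ y ≤ m₂ * (ψ x' - f₂ (x' - y)) := by linarith
    have h3 := le_of_mul_le_mul_left h2 hm₂
    exact norm_le_of_penalty_le hc hAc hε0 hL hB2 (show f₂ (x' - y) ≤ _ by linarith)
  have hyz : ‖y - z‖ < r / 2 := by
    have h1 := hFm z hzD z hzD z hzD
    rw [sub_self, hf₁0, hf₂0, norm_zero] at h1
    have h2 := hloc y (Metric.closedBall_subset_ball hrr₂ hyD.2) hyD.1
    have h3 : u x - f₁ (x - y) ≤ u y + (L + B) * (C * ε) := by
      have h5 : -(B * ‖x - y‖) ≤ f₁ (x - y) := hlow hB1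
      have h6 := mul_le_mul_of_nonneg_left hxy (add_nonneg hL hB0)
      linarith
    have h4 : ψ x' - f₂ (x' - y) ≤ ψ y + (L + B) * (C * ε) := by
      have h5 : -(B * ‖x' - y‖) ≤ f₂ (x' - y) := hlow hB2
      have h6 := mul_le_mul_of_nonneg_left hx'y (add_nonneg hL hB0)
      linarith
    have h3' := mul_le_mul_of_nonneg_left h3 hm₁.le
    have h4' := mul_le_mul_of_nonneg_left h4 hm₂.le
    have e : m₁ * ((L + B) * (C * ε)) + m₂ * ((L + B) * (C * ε)) = (L + B) * (C * ε) := by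
      rw [← add_mul, hm, one_mul]
    have h7 : ‖y - z‖ ^ 2 ≤ (L + B) * (C * ε) := by linarith
    exact lt_of_pow_lt_pow_left₀ 2 (by positivity) (h7.trans_lt hLCε)
  have hxz : x ∈ Metric.ball z r := by
    rw [Metric.mem_ball, dist_eq_norm]
    linarith [norm_sub_le_norm_sub_add_norm_sub x y z]
  have hx'z : x' ∈ Metric.ball z r := by
    rw [Metric.mem_ball, dist_eq_norm]
    linarith [norm_sub_le_norm_sub_add_norm_sub x' y z]
  have hyz' : y ∈ Metric.ball z r := by
    rw [Metric.mem_ball, dist_eq_norm]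
    linarith
  have hDmem : ∀ {w}, w ∈ Metric.ball z r → ∀ᶠ w' in 𝓝[closure Ω] w, w' ∈ D := by
    intro w hw
    filter_upwards [self_mem_nhdsWithin,
      mem_nhdsWithin_of_mem_nhds (Metric.isOpen_ball.mem_nhds hw)] with w' h1 h2
    exact ⟨h1, Metric.ball_subset_closedBall h2⟩
  set P₁ := ε⁻¹ • A (x - y) + b₁ with hP₁
  set P₂ := ε⁻¹ • A (x' - y) + b₂ with hP₂
  have hPn : ∀ {ξ b : EuclideanSpace ℝ (Fin n)}, ‖ξ‖ ≤ C * ε → ‖b‖ ≤ B →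
      ‖ε⁻¹ • A ξ + b‖ ≤ P₀ := by
    intro ξ b hξ hb
    refine (norm_add_le _ _).trans (add_le_add ?_ hb)
    rw [norm_smul, Real.norm_of_nonneg (by positivity), inv_mul_le_iff₀ hε0]
    refine (A.le_opNorm ξ).trans ?_
    calc ‖A‖ * ‖ξ‖ ≤ ‖A‖ * (C * ε) := mul_le_mul_of_nonneg_left hξ (norm_nonneg _)
      _ = _ := by ring
  have hP₁n : ‖P₁‖ ≤ P₀ := hPn hxy hB1
  have hP₂n : ‖P₂‖ ≤ P₀ := hPn hx'y hB2
  -- the boundary condition cannot be active for the subsolutions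
  have hbd : ∀ {ξ : EuclideanSpace ℝ (Fin n)} {k s : ℝ}, ξ ∈ Metric.ball z r → |k| ≤ Kk →
      k = g z + s + σ / 4 → ‖ξ - y‖ ≤ C * ε → ξ ∈ frontier Ω →
      g ξ + s < inner ℝ (γ ξ) (ε⁻¹ • A (ξ - y) + k • q) := by
    intro ξ k s hξ hk hks hξy hξΓ
    obtain ⟨-, h1, h2, h3⟩ := hfr ξ hξΓ (Metric.ball_subset_ball hrr₁.le hξ)
    have h3 := h3 y hyD.1 (Metric.ball_subset_ball hrr₁.le hyz')
    have h4 : -(κ * C) ≤ ε⁻¹ * inner ℝ (γ ξ) (A (ξ - y)) := by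
      rw [inv_mul_eq_div, le_div_iff₀ hε0]
      have := mul_le_mul_of_nonneg_left hξy hκ0.le
      linarith
    have h5 : k - κ * Kk ≤ k * inner ℝ (γ ξ) q := by
      have h6 : |k * ((inner ℝ (γ ξ) q : ℝ) - 1)| ≤ Kk * κ := by
        rw [abs_mul]
        exact mul_le_mul hk h1 (abs_nonneg _) ((abs_nonneg _).trans hk)
      linarith [neg_le_of_abs_le h6]
    rw [inner_add_right, real_inner_smul_right, real_inner_smul_right]
    linarith [(abs_le.1 h2).2]
  have hHx : H x P₁ ≤ s₁ := by
    have hlm : IsLocalMaxOn (fun w => u w - f₁ (w - y)) (closure Ω) x := by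
      filter_upwards [hDmem hxz] with w hw
      have h1 := hFm w hw x' hx'D y hyD
      exact le_of_mul_le_mul_left (by linarith) hm₁
    rcases hus x hxD.1 (Metric.ball_subset_ball hrr₀.le hxz) _ _
      (contDiff_penalty b₁ y).contDiffAt (hasGradientAt_penalty hAsym hε0.ne' b₁ x y) hlm
      with h | ⟨h1, h2⟩
    · exact h
    · exact absurd h2 (not_le.2 (hbd hxz hKk1 rfl hxy h1))
  have hHx' : H x' P₂ ≤ s₂ := by
    have hlm : IsLocalMaxOn (fun w => ψ w - f₂ (w - y)) (closure Ω) x' := by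
      filter_upwards [hDmem hx'z] with w hw
      have h1 := hFm x hxD w hw y hyD
      exact le_of_mul_le_mul_left (by linarith) hm₂
    rcases hψs x' hx'D.1 (Metric.ball_subset_ball hrr₀.le hx'z) _ _
      (contDiff_penalty b₂ y).contDiffAt (hasGradientAt_penalty hAsym hε0.ne' b₂ x' y) hlm
      with h | ⟨h1, h2⟩
    · exact h
    · exact absurd h2 (not_le.2 (hbd hx'z hKk2 rfl hx'y h1))
  set e : EuclideanSpace ℝ (Fin n) := (2 : ℝ) • (y - z) with he
  have hen : ‖e‖ ≤ r := by
    rw [he, norm_smul, Real.norm_ofNat]; linarith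
  set P₃ := m₁ • P₁ + m₂ • P₂ - e with hP₃
  have hHy : s₃ ≤ H y P₃ := by
    have hlm : IsLocalMinOn (fun w => v w -
        (-(m₁ * f₁ (x - w)) - m₂ * f₂ (x' - w) - ‖w - z‖ ^ 2)) (closure Ω) y := by
      filter_upwards [hDmem hyz'] with w hw
      have h1 := hFm x hxD x' hx'D w hw
      linarith
    have hgr : HasGradientAt (fun w => -(m₁ * f₁ (x - w)) - m₂ * f₂ (x' - w) - ‖w - z‖ ^ 2) P₃ y := by
      have h1 := (hasGradientAt_penalty_right hAsym hε0.ne' b₁ x y).fun_const_mul m₁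
      have h2 := (hasGradientAt_penalty_right hAsym hε0.ne' b₂ x' y).fun_const_mul m₂
      have h3 := (h1.fun_neg.fun_sub h2).fun_sub (hasGradientAt_norm_sq_sub (x := y) z)
      convert h3 using 1
      rw [smul_neg, smul_neg, neg_neg, sub_neg_eq_add]
    have hC1 : ContDiff ℝ 1 (fun w => -(m₁ * f₁ (x - w)) - m₂ * f₂ (x' - w) - ‖w - z‖ ^ 2) :=
      (((contDiff_const.mul (contDiff_penalty_right b₁ x)).neg).sub
        (contDiff_const.mul (contDiff_penalty_right b₂ x'))).sub
        ((contDiff_id.sub contDiff_const).norm_sq ℝ)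
    rcases hvs y hyD.1 (Metric.ball_subset_ball hrr₀.le hyz') _ _ hC1.contDiffAt hgr hlm
      with h | ⟨hyΓ, h⟩
    · exact h
    exfalso
    obtain ⟨hG, h1, h2, h3⟩ := hfr y hyΓ (Metric.ball_subset_ball hrr₁.le hyz')
    have hA3 : ∀ {ξ : EuclideanSpace ℝ (Fin n)} {k : ℝ}, ξ ∈ D → |k| ≤ Kk →
        ‖ξ - y‖ ≤ C * ε → (inner ℝ (γ y) (ε⁻¹ • A (ξ - y) + k • q) : ℝ) ≤ κ * C + k + κ * Kk := by
      intro ξ k hξ hk hξy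
      -- Now `y` is the boundary point, so the one-sided inequality is used with the roles exchanged
      -- and bounds the `γ`-derivative from above.
      have h4 := h3 ξ hξ.1 (Metric.closedBall_subset_ball hrr₁ hξ.2)
      rw [← neg_sub ξ y, map_neg, inner_neg_right, norm_neg] at h4
      have h5 : ε⁻¹ * inner ℝ (γ y) (A (ξ - y)) ≤ κ * C := by
        rw [inv_mul_le_iff₀ hε0]
        have := mul_le_mul_of_nonneg_left hξy hκ0.le
        linarith
      have h6 : |k * ((inner ℝ (γ y) q : ℝ) - 1)| ≤ Kk * κ := by
        rw [abs_mul]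
        exact mul_le_mul hk h1 (abs_nonneg _) ((abs_nonneg _).trans hk)
      rw [inner_add_right, real_inner_smul_right, real_inner_smul_right]
      linarith [le_of_abs_le h6]
    have h7 := mul_le_mul_of_nonneg_left (hA3 hxD hKk1 hxy) hm₁.le
    have h8 := mul_le_mul_of_nonneg_left (hA3 hx'D hKk2 hx'y) hm₂.le
    have h9 : -(inner ℝ (γ y) e : ℝ) ≤ σ / 8 := by
      have i1 := neg_le_of_abs_le (abs_real_inner_le_norm (γ y) e)
      have i2 : ‖γ y‖ * ‖e‖ ≤ |G| * (2 * r) :=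
        mul_le_mul (hG.trans (le_abs_self G)) (hen.trans (by linarith)) (norm_nonneg _)
          (abs_nonneg _)
      linarith
    have h10 : (inner ℝ (γ y) P₃ : ℝ) =
        m₁ * inner ℝ (γ y) P₁ + m₂ * inner ℝ (γ y) P₂ - inner ℝ (γ y) e := by
      rw [hP₃, inner_sub_right, inner_add_right, real_inner_smul_right, real_inner_smul_right]
    have h11 : m₁ * (κ * C + k₁ + κ * Kk) + m₂ * (κ * C + k₂ + κ * Kk)
        = κ * C + κ * Kk + g z + σ / 4 + (m₁ * s₁ + m₂ * s₂) := by
      have : m₂ = 1 - m₁ := by linarith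
      rw [hk₁, hk₂, this]; ring
    rw [h10] at h
    linarith [(abs_le.1 h2).1]
  -- Only the inequalities for `H` are left. Convexity at `y` combines `P₁` and `P₂`, and uniform
  -- continuity pays for moving the base points and for `e`.
  have hconv := (hP.convexOn y hyD.1).2 (mem_univ P₁) (mem_univ P₂) hm₁.le hm₂.le hm
  rw [smul_eq_mul, smul_eq_mul] at hconv
  have hcn : ‖m₁ • P₁ + m₂ • P₂‖ ≤ P₀ := by
    refine (norm_add_le _ _).trans ?_
    rw [norm_smul, norm_smul, Real.norm_of_nonneg hm₁.le, Real.norm_of_nonneg hm₂.le]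
    calc m₁ * ‖P₁‖ + m₂ * ‖P₂‖ ≤ m₁ * P₀ + m₂ * P₀ := by gcongr
      _ = P₀ := by rw [← add_mul, hm, one_mul]
  have hP₃n : ‖P₃‖ ≤ P₀ + 2 := (norm_sub_le _ _).trans (by linarith)
  have d1 : ‖y - x‖ < τ := by rw [norm_sub_rev]; linarith
  have d2 : ‖y - x'‖ < τ := by rw [norm_sub_rev]; linarith
  have i1 := hH y hyD.1 y hyD.1 (by simpa using hτ) P₃ (m₁ • P₁ + m₂ • P₂) hP₃n (by linarith)
    (by rw [hP₃, sub_sub_cancel_left, norm_neg]; linarith)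
  have i2 := hH y hyD.1 x hxD.1 d1 P₁ P₁ (by linarith) (by linarith) (by simpa using hτ)
  have i3 := hH y hyD.1 x' hx'D.1 d2 P₂ P₂ (by linarith) (by linarith) (by simpa using hτ)
  have j1 : m₁ * H y P₁ ≤ m₁ * (s₁ + σ / 4) := mul_le_mul_of_nonneg_left (by linarith) hm₁.le
  have j2 : m₂ * H y P₂ ≤ m₂ * (s₂ + σ / 4) := mul_le_mul_of_nonneg_left (by linarith) hm₂.le
  have j3 : m₁ * (s₁ + σ / 4) + m₂ * (s₂ + σ / 4) = m₁ * s₁ + m₂ * s₂ + σ / 4 := by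
    have : m₂ = 1 - m₁ := by linarith
    rw [this]; ring
  linarith

end IsNeumannProblem

/-! ### Strict inequalities, classical test functions, convex combinations, bumps. -/

/-- Two strict inequalities, the second one only required on a closed subset, persist uniformly
near a point. -/
theorem exists_uniform_pos {E : Type*} [NormedAddCommGroup E] {S Γ : Set E} (hΓ : IsClosed Γ)
    {a b : E × E → ℝ} (ha : ContinuousOn a (S ×ˢ univ)) (hb : ContinuousOn b (Γ ×ˢ univ))
    {z p : E} (hz : z ∈ S) (hap : 0 < a (z, p)) (hbp : z ∈ Γ → 0 < b (z, p)) :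
    ∃ η > 0, ∃ δ > 0, ∀ x ∈ S, ‖x - z‖ < δ → ∀ p', ‖p' - p‖ < δ →
      η < a (x, p') ∧ (x ∈ Γ → η < b (x, p')) := by
  have hA : ∃ η > 0, ∃ δ > 0, ∀ x ∈ S, ‖x - z‖ < δ → ∀ p', ‖p' - p‖ < δ → η < a (x, p') := by
    have h1 := (ha (z, p) ⟨hz, mem_univ _⟩).eventually_const_lt (half_lt_self hap)
    obtain ⟨δ, hδ, h⟩ := Metric.eventually_nhds_iff_ball.1 (eventually_nhdsWithin_iff.1 h1)
    refine ⟨_, half_pos hap, δ, hδ, fun x hx hxz p' hp' => h (x, p') ?_ ⟨hx, mem_univ _⟩⟩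
    rw [← ball_prod_same]
    exact ⟨by rwa [Metric.mem_ball, dist_eq_norm], by rwa [Metric.mem_ball, dist_eq_norm]⟩
  have hB : ∃ η > 0, ∃ δ > 0, ∀ x ∈ Γ, ‖x - z‖ < δ → ∀ p', ‖p' - p‖ < δ → η < b (x, p') := by
    by_cases hzΓ : z ∈ Γ
    · have hbp := hbp hzΓ
      have h1 := (hb (z, p) ⟨hzΓ, mem_univ _⟩).eventually_const_lt (half_lt_self hbp)
      obtain ⟨δ, hδ, h⟩ := Metric.eventually_nhds_iff_ball.1 (eventually_nhdsWithin_iff.1 h1)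
      refine ⟨_, half_pos hbp, δ, hδ, fun x hx hxz p' hp' => h (x, p') ?_ ⟨hx, mem_univ _⟩⟩
      rw [← ball_prod_same]
      exact ⟨by rwa [Metric.mem_ball, dist_eq_norm], by rwa [Metric.mem_ball, dist_eq_norm]⟩
    · obtain ⟨δ, hδ, h⟩ := Metric.isOpen_iff.1 hΓ.isOpen_compl z hzΓ
      refine ⟨1, one_pos, δ, hδ, fun x hx hxz => absurd hx (h ?_)⟩
      rwa [Metric.mem_ball, dist_eq_norm]
  obtain ⟨η₁, hη₁, δ₁, hδ₁, h₁⟩ := hA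
  obtain ⟨η₂, hη₂, δ₂, hδ₂, h₂⟩ := hB
  refine ⟨min η₁ η₂, lt_min hη₁ hη₂, min δ₁ δ₂, lt_min hδ₁ hδ₂, fun x hx hxz p' hp' => ⟨?_, ?_⟩⟩
  · exact (min_le_left _ _).trans_lt (h₁ x hx (hxz.trans_le (min_le_left _ _)) p'
      (hp'.trans_le (min_le_left _ _)))
  · exact fun hxΓ => (min_le_right _ _).trans_lt (h₂ x hxΓ (hxz.trans_le (min_le_right _ _)) p'
      (hp'.trans_le (min_le_right _ _)))

namespace IsNeumannProblem

variable {n : ℕ} {Ω : Set (EuclideanSpace ℝ (Fin n))}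
  {H : EuclideanSpace ℝ (Fin n) → EuclideanSpace ℝ (Fin n) → ℝ}
  {γ : EuclideanSpace ℝ (Fin n) → EuclideanSpace ℝ (Fin n)}
  {g : EuclideanSpace ℝ (Fin n) → ℝ} {x y z p : EuclideanSpace ℝ (Fin n)} {s : ℝ}

theorem continuousOn_inner_sub (hP : IsNeumannProblem Ω H γ g) (s : ℝ) :
    ContinuousOn (fun q : EuclideanSpace ℝ (Fin n) × EuclideanSpace ℝ (Fin n) =>
      (inner ℝ (γ q.1) q.2 : ℝ) - (g q.1 + s)) (frontier Ω ×ˢ univ) := by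
  have h1 : ContinuousOn (fun q : EuclideanSpace ℝ (Fin n) × EuclideanSpace ℝ (Fin n) => γ q.1)
      (frontier Ω ×ˢ univ) := hP.continuousOn_γ.comp continuousOn_fst fun q hq => hq.1
  have h2 : ContinuousOn (fun q : EuclideanSpace ℝ (Fin n) × EuclideanSpace ℝ (Fin n) => g q.1)
      (frontier Ω ×ˢ univ) := hP.continuousOn_g.comp continuousOn_fst fun q hq => hq.1
  exact (h1.inner continuousOn_snd).sub (h2.add continuousOn_const)

/-- Failure of the inequality is open in `(x, p)` and comes with a margin. Thus a test function that
violates it at one point is a strict classical supersolution nearby. -/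
theorem exists_uniform_not_subAt (hP : IsNeumannProblem Ω H γ g) (hz : z ∈ closure Ω)
    (h : ¬ SubAt Ω H γ g s z p) :
    ∃ η > 0, ∃ δ > 0, ∀ x ∈ closure Ω, ‖x - z‖ < δ → ∀ p', ‖p' - p‖ < δ →
      s + η < H x p' ∧ (x ∈ frontier Ω → g x + (s + η) < inner ℝ (γ x) p') := by
  simp only [SubAt, not_or, not_and, not_le] at h
  obtain ⟨η, hη, δ, hδ, hx⟩ := exists_uniform_pos isClosed_frontier
    (hP.continuousOn_H.sub (continuousOn_const (c := s))) (hP.continuousOn_inner_sub s) hz (p := p)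
    (sub_pos.2 h.1) (fun hzΓ => sub_pos.2 (h.2 hzΓ))
  refine ⟨η, hη, δ, hδ, fun x hxS hxz p' hp' => ?_⟩
  have := hx x hxS hxz p' hp'
  simp only [Pi.sub_apply] at this
  exact ⟨by linarith [this.1], fun hxΓ => by linarith [this.2 hxΓ]⟩

theorem exists_uniform_not_superAt (hP : IsNeumannProblem Ω H γ g) (hz : z ∈ closure Ω)
    (h : ¬ SuperAt Ω H γ g s z p) :
    ∃ η > 0, ∃ δ > 0, ∀ x ∈ closure Ω, ‖x - z‖ < δ → ∀ p', ‖p' - p‖ < δ →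
      H x p' < s - η ∧ (x ∈ frontier Ω → inner ℝ (γ x) p' < g x + (s - η)) := by
  simp only [SuperAt, not_or, not_and, not_le] at h
  obtain ⟨η, hη, δ, hδ, hx⟩ := exists_uniform_pos isClosed_frontier
    ((continuousOn_const (c := s)).sub hP.continuousOn_H) (hP.continuousOn_inner_sub s).neg hz
    (p := p) (sub_pos.2 h.1) (fun hzΓ => by simpa using h.2 hzΓ)
  refine ⟨η, hη, δ, hδ, fun x hxS hxz p' hp' => ?_⟩
  have := hx x hxS hxz p' hp'
  simp only [Pi.neg_apply, Pi.sub_apply] at this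
  exact ⟨by linarith [this.1], fun hxΓ => by linarith [this.2 hxΓ]⟩

theorem gradient_eq_zero_of_isLocalMaxOn (hP : IsNeumannProblem Ω H γ g) (hx : x ∈ Ω)
    {f : EuclideanSpace ℝ (Fin n) → ℝ} (hf : HasGradientAt f p x)
    (hm : IsLocalMaxOn f (closure Ω) x) : p = 0 := by
  have hloc : IsLocalMax f x := hm.isLocalMax
    (mem_of_superset (hP.isOpen.mem_nhds hx) subset_closure)
  have := hloc.hasFDerivAt_eq_zero (hasGradientAt_iff_hasFDerivAt.1 hf)
  simpa using this

/-- The direction `-γ` enters `Ω`, so the one-sided derivative along it at a maximum is nonpositive.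
-/
theorem inner_nonneg_of_isLocalMaxOn (hP : IsNeumannProblem Ω H γ g) (hx : x ∈ frontier Ω)
    {f : EuclideanSpace ℝ (Fin n) → ℝ} (hf : HasGradientAt f p x)
    (hm : IsLocalMaxOn f (closure Ω) x) : 0 ≤ (inner ℝ (γ x) p : ℝ) := by
  have hline : HasDerivAt (fun t : ℝ => x - t • γ x) (-γ x) 0 := by
    simpa using ((hasDerivAt_id (0 : ℝ)).smul_const (γ x)).const_sub x
  have hgr : HasFDerivAt f (InnerProductSpace.toDual ℝ _ p) (x - (0 : ℝ) • γ x) := by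
    simpa using hasGradientAt_iff_hasFDerivAt.1 hf
  have hd : HasDerivAt (fun t : ℝ => f (x - t • γ x)) (-(inner ℝ (γ x) p)) 0 := by
    have := hgr.comp_hasDerivAt (0 : ℝ) hline
    simpa [Function.comp_def, real_inner_comm] using this
  have hcont : Tendsto (fun t : ℝ => x - t • γ x) (𝓝[>] 0) (𝓝[closure Ω] x) := by
    refine tendsto_nhdsWithin_iff.2 ⟨?_, (hP.eventually_sub_smul_mem hx).mono fun t ht =>
      subset_closure ht⟩
    have : Tendsto (fun t : ℝ => x - t • γ x) (𝓝 0) (𝓝 (x - (0 : ℝ) • γ x)) :=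
      (by fun_prop : Continuous fun t : ℝ => x - t • γ x).tendsto 0
    simp only [zero_smul, sub_zero] at this
    exact this.mono_left nhdsWithin_le_nhds
  have hle : -(inner ℝ (γ x) p : ℝ) ≤ 0 := by
    refine le_of_tendsto hd.tendsto_slope_zero_right ?_
    filter_upwards [hcont.eventually hm, self_mem_nhdsWithin] with t ht ht0
    have ht0 : 0 < t := ht0
    simp only [zero_add, zero_smul, sub_zero, smul_eq_mul]
    exact mul_nonpos_of_nonneg_of_nonpos (inv_nonneg.2 ht0.le) (by linarith)
  linarith

/-- A `C¹` function satisfying the subsolution inequalities classically does so in the viscosity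
sense. -/
theorem subAt_of_isLocalMaxOn (hP : IsNeumannProblem Ω H γ g) (hx : x ∈ closure Ω)
    {f φ : EuclideanSpace ℝ (Fin n) → ℝ} {p' : EuclideanSpace ℝ (Fin n)}
    (hf : HasGradientAt f p x) (hφ : HasGradientAt φ p' x) (h1 : H x p ≤ s)
    (h2 : x ∈ frontier Ω → inner ℝ (γ x) p ≤ g x + s)
    (hm : IsLocalMaxOn (fun w => f w - φ w) (closure Ω) x) : SubAt Ω H γ g s x p' := by
  rcases hP.mem_or_mem_frontier hx with hx' | hx'
  · have := hP.gradient_eq_zero_of_isLocalMaxOn hx' (hf.fun_sub hφ) hm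
    rw [sub_eq_zero] at this
    exact Or.inl (this ▸ h1)
  · have := hP.inner_nonneg_of_isLocalMaxOn hx' (hf.fun_sub hφ) hm
    rw [inner_sub_right] at this
    exact Or.inr ⟨hx', by linarith [h2 hx']⟩

theorem superAt_of_isLocalMinOn (hP : IsNeumannProblem Ω H γ g) (hx : x ∈ closure Ω)
    {f φ : EuclideanSpace ℝ (Fin n) → ℝ} {p' : EuclideanSpace ℝ (Fin n)}
    (hf : HasGradientAt f p x) (hφ : HasGradientAt φ p' x) (h1 : s ≤ H x p)
    (h2 : x ∈ frontier Ω → g x + s ≤ inner ℝ (γ x) p)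
    (hm : IsLocalMinOn (fun w => f w - φ w) (closure Ω) x) : SuperAt Ω H γ g s x p' := by
  have hm' : IsLocalMaxOn (fun w => φ w - f w) (closure Ω) x := by
    filter_upwards [hm] with w hw
    linarith
  rcases hP.mem_or_mem_frontier hx with hx' | hx'
  · have := hP.gradient_eq_zero_of_isLocalMaxOn hx' (hφ.fun_sub hf) hm'
    rw [sub_eq_zero] at this
    exact Or.inl (this ▸ h1)
  · have := hP.inner_nonneg_of_isLocalMaxOn hx' (hφ.fun_sub hf) hm'
    rw [inner_sub_right] at this
    exact Or.inr ⟨hx', by linarith [h2 hx']⟩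

/-- The local Lipschitz estimate on all smaller balls. -/
theorem exists_common_lipschitz (hP : IsNeumannProblem Ω H γ g) (hz : z ∈ closure Ω) :
    ∃ r > 0, ∃ L ≥ 0, ∀ u : EuclideanSpace ℝ (Fin n) → ℝ,
      UpperSemicontinuousOn u (closure Ω) → SubOn Ω H γ g univ 0 u →
      ∀ r' ≤ r, ∀ x ∈ closure Ω ∩ Metric.ball z r', ∀ y ∈ closure Ω ∩ Metric.ball z r',
        u x ≤ u y + L * ‖x - y‖ := by
  obtain ⟨r, hr, L, hL, h⟩ := hP.exists_lipschitz hz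
  exact ⟨r, hr, L, hL, fun u hu hus r' hr' x hx y hy => h u hu hus x hx.1
    (Metric.ball_subset_ball hr' hx.2) y hy.1 (Metric.ball_subset_ball hr' hy.2)⟩

theorem continuousOn_of_subOn (hP : IsNeumannProblem Ω H γ g)
    {u : EuclideanSpace ℝ (Fin n) → ℝ} (hu : UpperSemicontinuousOn u (closure Ω))
    (hus : SubOn Ω H γ g univ 0 u) : ContinuousOn u (closure Ω) := by
  intro x hx
  obtain ⟨r, hr, L, hL, h⟩ := hP.exists_common_lipschitz hx
  have := continuousOn_of_le_add_mul_norm hL (h u hu hus r le_rfl)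
  exact (this x ⟨hx, Metric.mem_ball_self hr⟩).mono_of_mem_nhdsWithin
    (inter_mem self_mem_nhdsWithin (mem_nhdsWithin_of_mem_nhds (Metric.ball_mem_nhds x hr)))

/-- Convex combinations of subsolutions are subsolutions, quantitatively. -/
theorem subOn_convexComb (hP : IsNeumannProblem Ω H γ g)
    {u ψ : EuclideanSpace ℝ (Fin n) → ℝ} {U : Set (EuclideanSpace ℝ (Fin n))} {s₁ s₂ m₁ m₂ : ℝ}
    (hU : IsOpen U)
    (hu : UpperSemicontinuousOn u (closure Ω)) (hu0 : SubOn Ω H γ g univ 0 u)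
    (hψ : UpperSemicontinuousOn ψ (closure Ω)) (hψ0 : SubOn Ω H γ g univ 0 ψ)
    (hus : SubOn Ω H γ g U s₁ u) (hψs : SubOn Ω H γ g U s₂ ψ)
    (hm₁ : 0 < m₁) (hm₂ : 0 < m₂) (hm : m₁ + m₂ = 1) :
    SubOn Ω H γ g U (m₁ * s₁ + m₂ * s₂) (fun x => m₁ * u x + m₂ * ψ x) := by
  intro z hz hzU χ p hχ hp hmax
  by_contra hcon
  obtain ⟨η, hη, δ, hδ, hnot⟩ := hP.exists_uniform_not_subAt hz hcon
  obtain ⟨r₁, hr₁, L, hL, hLip⟩ := hP.exists_common_lipschitz hz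
  obtain ⟨r₂, hr₂, hrU⟩ := Metric.isOpen_iff.1 hU z hzU
  have hgz : gradient χ z = p := hp.gradient
  have hev : ∀ᶠ x in 𝓝 z, ContDiffAt ℝ 1 χ x ∧ ‖gradient χ x - p‖ < δ := by
    refine (hχ.eventually (by simp)).and ?_
    have := hχ.continuousAt_gradient
    rw [ContinuousAt, hgz, tendsto_iff_norm_sub_tendsto_zero] at this
    exact this.eventually_lt_const hδ
  obtain ⟨r₃, hr₃, hball⟩ := Metric.eventually_nhds_iff_ball.1 hev
  set r := min (min r₁ r₂) (min r₃ δ) with hr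
  have i1 : r ≤ r₁ := (min_le_left _ _).trans (min_le_left _ _)
  have i2 : r ≤ r₂ := (min_le_left _ _).trans (min_le_right _ _)
  have i3 : r ≤ r₃ := (min_le_right _ _).trans (min_le_left _ _)
  have i4 : r ≤ δ := (min_le_right _ _).trans (min_le_right _ _)
  have hr0 : 0 < r := by positivity
  have hsub : Metric.ball z r ⊆ U := (Metric.ball_subset_ball i2).trans hrU
  -- The test function itself plays the supersolution, at a level higher by `η`.
  refine hP.not_isLocalMaxOn hz hr0 hL (hLip u hu hu0 r i1) (hLip ψ hψ hψ0 r i1)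
    (ContinuousOn.lowerSemicontinuousOn ?_) (hus.mono hsub le_rfl) (hψs.mono hsub le_rfl)
    (s₃ := m₁ * s₁ + m₂ * s₂ + η) (v := χ) ?_ hm₁ hm₂ hm (by linarith) hmax
  · intro x hx
    exact (hball x (Metric.ball_subset_ball i3 hx.2)).1.continuousAt.continuousWithinAt
  · intro x hx hxr φ p' _ hp' hmin
    obtain ⟨hC, hg⟩ := hball x (Metric.ball_subset_ball i3 hxr)
    have hxz : ‖x - z‖ < δ := by rw [← dist_eq_norm]; exact lt_of_lt_of_le hxr i4
    obtain ⟨k1, k2⟩ := hnot x hx hxz _ hg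
    exact hP.superAt_of_isLocalMinOn hx hC.hasGradientAt hp' k1.le (fun h => (k2 h).le) hmin

/-- If a test function from below violates the supersolution inequality, then the subsolution
can be raised near the contact point, and the new subsolution is strict there. -/
theorem exists_bump (hP : IsNeumannProblem Ω H γ g) {D φ : EuclideanSpace ℝ (Fin n) → ℝ}
    (hD : ContinuousOn D (closure Ω)) (hDs : SubOn Ω H γ g univ 0 D) (hz : z ∈ closure Ω)
    (hφ : ContDiff ℝ 1 φ) (hmin : IsMinOn (fun x => D x - φ x) (closure Ω) z)
    (hnot : ¬ SuperAt Ω H γ g 0 z (gradient φ z)) {ε₀ : ℝ} (hε₀ : 0 < ε₀) :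
    ∃ ε > 0, ∃ w : EuclideanSpace ℝ (Fin n) → ℝ, ε < ε₀ ∧ ContinuousOn w (closure Ω) ∧
      SubOn Ω H γ g univ 0 w ∧ w z = D z + ε ∧
      (∀ x ∈ closure Ω, ε ≤ ‖x - z‖ ^ 2 → w x = D x) ∧
      ∃ δ > 0, ∃ r > 0, SubOn Ω H γ g (Metric.ball z r) (-δ) w := by
  obtain ⟨η, hη, δ, hδ, hlt⟩ := hP.exists_uniform_not_superAt hz hnot
  have hgr : ∀ x (c : ℝ), HasGradientAt (fun x => φ x + c - ‖x - z‖ ^ 2)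
      (gradient φ x - (2 : ℝ) • (x - z)) x := by
    intro x c
    have h := (hφ.contDiffAt.hasGradientAt (x := x)).fun_add (hasGradientAt_const x c)
    rw [add_zero] at h
    exact h.fun_sub (hasGradientAt_norm_sq_sub z)
  have hev : ∀ᶠ x in 𝓝 z, ‖gradient φ x - (2 : ℝ) • (x - z) - gradient φ z‖ < δ := by
    have hc : ContinuousAt (fun x => gradient φ x - (2 : ℝ) • (x - z)) z :=
      hφ.contDiffAt.continuousAt_gradient.sub (by fun_prop)
    rw [ContinuousAt, sub_self, smul_zero, sub_zero, tendsto_iff_norm_sub_tendsto_zero] at hc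
    exact hc.eventually_lt_const hδ
  obtain ⟨r₁, hr₁, hball⟩ := Metric.eventually_nhds_iff_ball.1 hev
  set r := min r₁ δ with hr
  have hr0 : 0 < r := lt_min hr₁ hδ
  -- Since `f ≤ D + ε - ‖x - z‖ ^ 2`, the set `{D < f}` lies where `‖x - z‖ ^ 2 < ε < r ^ 2`, and
  -- there `f` satisfies the strict inequalities classically. The candidate is `max D f`.
  set ε := min (ε₀ / 2) (r ^ 2 / 2) with hε
  have hε0 : 0 < ε := by positivity
  have hεr : ε < r ^ 2 := by
    have := min_le_right (ε₀ / 2) (r ^ 2 / 2)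
    have : 0 < r ^ 2 := by positivity
    linarith
  set c : ℝ := D z - φ z + ε with hc
  set f : EuclideanSpace ℝ (Fin n) → ℝ := fun x => φ x + c - ‖x - z‖ ^ 2 with hf
  have hfD : ∀ x ∈ closure Ω, f x ≤ D x + ε - ‖x - z‖ ^ 2 := by
    intro x hx
    have : D z - φ z ≤ D x - φ x := hmin hx
    simp only [hf, hc]
    linarith
  have hfz : f z = D z + ε := by simp only [hf, hc, sub_self, norm_zero]; ring
  have hfc : Continuous f := (hφ.continuous.add continuous_const).sub (by fun_prop)
  have hstrict : ∀ x ∈ closure Ω, D x < f x → ∀ χ : EuclideanSpace ℝ (Fin n) → ℝ, ∀ p,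
      HasGradientAt χ p x → IsLocalMaxOn (fun y => max (D y) (f y) - χ y) (closure Ω) x →
      SubAt Ω H γ g (-η) x p := by
    intro x hx hDf χ p hp hm
    have hxz : ‖x - z‖ < r := by
      have := hfD x hx
      exact lt_of_pow_lt_pow_left₀ 2 hr0.le (by linarith)
    have hxb : x ∈ Metric.ball z r₁ := by
      rw [Metric.mem_ball, dist_eq_norm]
      exact hxz.trans_le (min_le_left _ _)
    obtain ⟨k1, k2⟩ := hlt x hx (hxz.trans_le (min_le_right _ _)) _ (hball x hxb)
    rw [zero_sub] at k1 k2
    refine hP.subAt_of_isLocalMaxOn hx (hgr x c) hp k1.le (fun h => (k2 h).le) ?_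
    filter_upwards [hm] with y hy
    rw [max_eq_right hDf.le] at hy
    linarith [le_max_right (D y) (f y)]
  refine ⟨ε, hε0, fun x => max (D x) (f x), ?_, hD.sup hfc.continuousOn, ?_, ?_, ?_, η, hη, ?_⟩
  · linarith [min_le_left (ε₀ / 2) (r ^ 2 / 2)]
  · intro x hx _ χ p hχ hp hm
    by_cases hDf : D x < f x
    · rcases hstrict x hx hDf χ p hp hm with h | h
      · exact Or.inl (by linarith)
      · exact Or.inr ⟨h.1, by linarith [h.2]⟩
    · refine hDs x hx (mem_univ _) χ p hχ hp ?_
      filter_upwards [hm] with y hy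
      rw [max_eq_left (not_lt.1 hDf)] at hy
      linarith [le_max_left (D y) (f y)]
  · show max (D z) (f z) = _
    rw [hfz, max_eq_right (by linarith)]
  · intro x hx hxz
    exact max_eq_left ((hfD x hx).trans (by linarith))
  · have hev2 : ∀ᶠ x in 𝓝[closure Ω] z, 0 < f x - D x :=
      (hfc.continuousWithinAt.sub (hD z hz)).eventually_const_lt (by
        rw [Pi.sub_apply, hfz]; linarith)
    obtain ⟨r₂, hr₂, hb⟩ := Metric.eventually_nhds_iff_ball.1 (eventually_nhdsWithin_iff.1 hev2)
    exact ⟨r₂, hr₂, fun x hx hxr χ p _ hp hm =>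
      hstrict x hx (sub_pos.1 (hb x hxr hx)) χ p hp hm⟩

end IsNeumannProblem

/-! ### The function `d`, strict subsolutions and comparison. -/

namespace IsNeumannProblem

variable {n : ℕ} {Ω : Set (EuclideanSpace ℝ (Fin n))}
  {H : EuclideanSpace ℝ (Fin n) → EuclideanSpace ℝ (Fin n) → ℝ}
  {γ : EuclideanSpace ℝ (Fin n) → EuclideanSpace ℝ (Fin n)}
  {g : EuclideanSpace ℝ (Fin n) → ℝ} {x y z : EuclideanSpace ℝ (Fin n)}
  {u v w : EuclideanSpace ℝ (Fin n) → ℝ}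

/-- A uniform bound on oscillation between two points is a symmetric, transitive relation that holds
locally by the Lipschitz estimate; connectedness spreads it. Without it the real supremum defining
`d` could be a default value. -/
theorem bddAbove_subsolutionDist (hP : IsNeumannProblem Ω H γ g) (hx : x ∈ closure Ω)
    (hy : y ∈ closure Ω) :
    BddAbove {t : ℝ | ∃ v : EuclideanSpace ℝ (Fin n) → ℝ,
      UpperSemicontinuousOn v (closure Ω) ∧ IsSubsolution Ω H γ g 0 v ∧ t = v x - v y} := by
  have key := hP.isConnected.isPreconnected.closure.induction₂
    (fun x y => ∃ C : ℝ, ∀ v : EuclideanSpace ℝ (Fin n) → ℝ,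
      UpperSemicontinuousOn v (closure Ω) → IsSubsolution Ω H γ g 0 v → |v x - v y| ≤ C)
    (fun x hx => ?_) (fun a b c _ _ _ => ?_) (fun a b _ _ => ?_) hx hy
  · obtain ⟨C, hC⟩ := key
    refine ⟨C, ?_⟩
    rintro _ ⟨v, hv, hvs, rfl⟩
    exact (le_abs_self _).trans (hC v hv hvs)
  · obtain ⟨r, hr, L, hL, h⟩ := hP.exists_lipschitz hx
    filter_upwards [self_mem_nhdsWithin,
      mem_nhdsWithin_of_mem_nhds (Metric.ball_mem_nhds x hr)] with y hy hyr
    refine ⟨L * ‖x - y‖, fun v hv hvs => ?_⟩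
    have h1 := h v hv (hvs.subOn hP hv) x hx (Metric.mem_ball_self hr) y hy hyr
    have h2 := h v hv (hvs.subOn hP hv) y hy hyr x hx (Metric.mem_ball_self hr)
    rw [norm_sub_rev] at h2
    exact abs_le.2 ⟨by linarith, by linarith⟩
  · rintro ⟨C₁, h₁⟩ ⟨C₂, h₂⟩
    refine ⟨C₁ + C₂, fun v hv hvs => (abs_sub_le _ (v b) _).trans ?_⟩
    exact add_le_add (h₁ v hv hvs) (h₂ v hv hvs)
  · rintro ⟨C, h⟩
    exact ⟨C, fun v hv hvs => by rw [abs_sub_comm]; exact h v hv hvs⟩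

theorem sub_le_subsolutionDist (hP : IsNeumannProblem Ω H γ g) (hx : x ∈ closure Ω)
    (hy : y ∈ closure Ω) (hw : UpperSemicontinuousOn w (closure Ω))
    (hws : IsSubsolution Ω H γ g 0 w) : w x - w y ≤ subsolutionDist Ω H γ g x y :=
  le_csSup (hP.bddAbove_subsolutionDist hx hy) ⟨w, hw, hws, rfl⟩

theorem subsolutionDist_self (hw : UpperSemicontinuousOn w (closure Ω))
    (hws : IsSubsolution Ω H γ g 0 w) : subsolutionDist Ω H γ g y y = 0 := by
  have : {t : ℝ | ∃ v : EuclideanSpace ℝ (Fin n) → ℝ,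
      UpperSemicontinuousOn v (closure Ω) ∧ IsSubsolution Ω H γ g 0 v ∧ t = v y - v y} = {0} := by
    ext t
    simp only [sub_self, mem_ofPred_eq, mem_singleton_iff]
    exact ⟨fun ⟨_, _, _, h⟩ => h, fun h => ⟨w, hw, hws, h⟩⟩
  rw [subsolutionDist, this, csSup_singleton]

theorem exists_lt_sub (hw : UpperSemicontinuousOn w (closure Ω))
    (hws : IsSubsolution Ω H γ g 0 w) {c : ℝ} (hc : c < subsolutionDist Ω H γ g x y) :
    ∃ v : EuclideanSpace ℝ (Fin n) → ℝ, UpperSemicontinuousOn v (closure Ω) ∧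
      IsSubsolution Ω H γ g 0 v ∧ c < v x - v y := by
  have hne : {t : ℝ | ∃ v : EuclideanSpace ℝ (Fin n) → ℝ,
      UpperSemicontinuousOn v (closure Ω) ∧ IsSubsolution Ω H γ g 0 v ∧ t = v x - v y}.Nonempty :=
    ⟨_, w, hw, hws, rfl⟩
  obtain ⟨_, ⟨v, hv, hvs, rfl⟩, h⟩ := exists_lt_of_lt_csSup hne hc
  exact ⟨v, hv, hvs, h⟩

theorem continuousOn_subsolutionDist (hP : IsNeumannProblem Ω H γ g) (hy : y ∈ closure Ω)
    (hw : UpperSemicontinuousOn w (closure Ω)) (hws : IsSubsolution Ω H γ g 0 w) :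
    ContinuousOn (fun x => subsolutionDist Ω H γ g x y) (closure Ω) := by
  intro x hx
  obtain ⟨r, hr, L, hL, h⟩ := hP.exists_common_lipschitz hx
  have hlip : ∀ a ∈ closure Ω ∩ Metric.ball x r, ∀ b ∈ closure Ω ∩ Metric.ball x r,
      subsolutionDist Ω H γ g a y ≤ subsolutionDist Ω H γ g b y + L * ‖a - b‖ := by
    intro a ha b hb
    refine le_of_forall_lt fun c hc => ?_
    obtain ⟨v, hv, hvs, hcv⟩ := exists_lt_sub hw hws hc
    have h1 := h v hv (hvs.subOn hP hv) r le_rfl a ha b hb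
    have h2 := hP.sub_le_subsolutionDist hb.1 hy hv hvs
    linarith
  exact (continuousOn_of_le_add_mul_norm hL hlip x ⟨hx, Metric.mem_ball_self hr⟩).mono_of_mem_nhdsWithin
    (inter_mem self_mem_nhdsWithin (mem_nhdsWithin_of_mem_nhds (Metric.ball_mem_nhds x hr)))

/-- Suprema of subsolutions are subsolutions. If a test failed at `z`, a nearly optimal competitor
would be touched near `z` by a slight perturbation of the same test function, which still violates
the inequality. -/
theorem subOn_subsolutionDist (hP : IsNeumannProblem Ω H γ g) (hy : y ∈ closure Ω)
    (hw : UpperSemicontinuousOn w (closure Ω)) (hws : IsSubsolution Ω H γ g 0 w) :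
    SubOn Ω H γ g univ 0 (fun x => subsolutionDist Ω H γ g x y) := by
  intro z hz _ φ p hφ hp hmax
  by_contra hcon
  obtain ⟨η, hη, δ, hδ, hnot⟩ := hP.exists_uniform_not_subAt hz hcon
  have hgz : gradient φ z = p := hp.gradient
  have hev : ∀ᶠ x in 𝓝 z, (ContDiffAt ℝ 1 φ x ∧ ‖gradient φ x + (2 : ℝ) • (x - z) - p‖ < δ) ∧
      (x ∈ closure Ω → subsolutionDist Ω H γ g x y - φ x ≤ subsolutionDist Ω H γ g z y - φ z) := by
    refine ((hφ.eventually (by simp)).and ?_).and (eventually_nhdsWithin_iff.1 hmax)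
    have : ContinuousAt (fun x => gradient φ x + (2 : ℝ) • (x - z)) z :=
      hφ.continuousAt_gradient.add (by fun_prop)
    rw [ContinuousAt, hgz, sub_self, smul_zero, add_zero, tendsto_iff_norm_sub_tendsto_zero] at this
    exact this.eventually_lt_const hδ
  obtain ⟨r₁, hr₁, hball⟩ := Metric.eventually_nhds_iff_ball.1 hev
  set r := min r₁ δ / 2 with hr
  have hr0 : 0 < r := by positivity
  have hrr₁ : r < r₁ := by have := min_le_left r₁ δ; linarith
  have hrδ : r < δ := by have := min_le_right r₁ δ; linarith
  -- The deficit `r ^ 2` is exactly what the quadratic term costs at distance `r`, so the maximum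
  -- for this competitor is attained inside the ball.
  obtain ⟨v, hv, hvs, hvz⟩ := exists_lt_sub hw hws
    (show subsolutionDist Ω H γ g z y - r ^ 2 < subsolutionDist Ω H γ g z y by
      have : 0 < r ^ 2 := by positivity
      linarith)
  set K := closure Ω ∩ Metric.closedBall z r with hK
  have hKc : IsCompact K := hP.isCompact_closure.inter_right Metric.isClosed_closedBall
  have hzK : z ∈ K := ⟨hz, Metric.mem_closedBall_self hr0.le⟩
  have husc : UpperSemicontinuousOn (fun x => v x + -(φ x + ‖x - z‖ ^ 2)) K := by
    refine (hv.mono inter_subset_left).add (ContinuousOn.upperSemicontinuousOn fun x hx => ?_)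
    have := (hball x (Metric.closedBall_subset_ball hrr₁ hx.2)).1.1.continuousAt
    exact (this.add (by fun_prop)).neg.continuousWithinAt
  obtain ⟨x, hxK, hxmax⟩ := husc.exists_isMaxOn ⟨z, hzK⟩ hKc
  obtain ⟨⟨hC, hg⟩, hle⟩ := hball x (Metric.closedBall_subset_ball hrr₁ hxK.2)
  have hxz : ‖x - z‖ < r := by
    have h1 : v z + -(φ z + ‖z - z‖ ^ 2) ≤ v x + -(φ x + ‖x - z‖ ^ 2) := hxmax hzK
    rw [sub_self, norm_zero] at h1
    have h2 := hP.sub_le_subsolutionDist hxK.1 hy hv hvs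
    have h3 := hle hxK.1
    exact lt_of_pow_lt_pow_left₀ 2 hr0.le (by linarith)
  have hgr : HasGradientAt (fun x => φ x + ‖x - z‖ ^ 2) (gradient φ x + (2 : ℝ) • (x - z)) x :=
    hC.hasGradientAt.fun_add (hasGradientAt_norm_sq_sub z)
  have hloc : IsLocalMaxOn (fun x => v x - (φ x + ‖x - z‖ ^ 2)) (closure Ω) x := by
    have hxb : x ∈ Metric.ball z r := by rwa [Metric.mem_ball, dist_eq_norm]
    filter_upwards [self_mem_nhdsWithin,
      mem_nhdsWithin_of_mem_nhds (Metric.isOpen_ball.mem_nhds hxb)] with a ha har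
    have := hxmax (show a ∈ K from ⟨ha, Metric.ball_subset_closedBall har⟩)
    simpa only [mem_ofPred_eq, ← sub_eq_add_neg] using this
  obtain ⟨k1, k2⟩ := hnot x hxK.1 (hxz.trans hrδ) _ hg
  rcases hvs.subOn hP hv x hxK.1 (mem_univ _) _ _
    (hC.add ((contDiffAt_id.sub contDiffAt_const).norm_sq ℝ)) hgr hloc with h | ⟨h1, h2⟩
  · linarith
  · linarith [k2 h1]

/-- Off the Aubry–Mather set there are subsolutions which are strict near the given point. -/
theorem exists_strict_subsolution (hP : IsNeumannProblem Ω H γ g) (hy : y ∈ closure Ω)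
    (hw : UpperSemicontinuousOn w (closure Ω)) (hws : IsSubsolution Ω H γ g 0 w)
    (hyA : y ∉ aubryMatherSet Ω H γ g) :
    ∃ ψ : EuclideanSpace ℝ (Fin n) → ℝ, ContinuousOn ψ (closure Ω) ∧ SubOn Ω H γ g univ 0 ψ ∧
      ∃ δ > 0, ∃ r > 0, SubOn Ω H γ g (Metric.ball y r) (-δ) ψ := by
  set D : EuclideanSpace ℝ (Fin n) → ℝ := fun x => subsolutionDist Ω H γ g x y with hD
  have hDc : ContinuousOn D (closure Ω) := hP.continuousOn_subsolutionDist hy hw hws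
  have hDs : SubOn Ω H γ g univ 0 D := hP.subOn_subsolutionDist hy hw hws
  have hnot : ¬ IsSupersolution Ω H γ g 0 D := fun h =>
    hyA ⟨hy, hDs.isSubsolution hP hDc.upperSemicontinuousOn, h⟩
  obtain ⟨z, hz, φ, hφ, hmin, hfail⟩ : ∃ z ∈ closure Ω, ∃ φ : EuclideanSpace ℝ (Fin n) → ℝ,
      ContDiff ℝ 1 φ ∧ IsMinOn (fun x => D x - φ x) (closure Ω) z ∧
      ¬ SuperAt Ω H γ g 0 z (gradient φ z) := by
    by_contra hcon
    push Not at hcon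
    refine hnot ⟨(hP.isCompact_closure.image_of_continuousOn hDc).bddBelow,
      fun x hx φ hφ hmin => ?_⟩
    have hlsc := hDc.lowerSemicontinuousOn
    have := hcon x hx φ hφ (by
      intro a ha
      have := hmin ha
      simpa only [mem_ofPred_eq, lscEnvelope_eq hlsc hx, lscEnvelope_eq hlsc ha] using this)
    refine ⟨fun hxΩ => this.resolve_right fun h => hP.notMem_frontier hxΩ h.1, fun _ => ?_⟩
    exact this.imp id fun h => by simpa using h.2
  -- At a failure point other than `y` the bump can be kept away from `y`, and the raised competitor
  -- contradicts the definition of `d`.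
  by_cases hzy : y = z
  · subst hzy
    obtain ⟨ε, -, ψ, -, hψc, hψs, -, -, hstrict⟩ :=
      hP.exists_bump hDc hDs hz hφ hmin hfail one_pos
    exact ⟨ψ, hψc, hψs, hstrict⟩
  · exfalso
    obtain ⟨ε, hε, ψ, hεlt, hψc, hψs, hψz, hψeq, -⟩ :=
      hP.exists_bump hDc hDs hz hφ hmin hfail
        (show 0 < ‖y - z‖ ^ 2 from pow_pos (norm_pos_iff.2 (sub_ne_zero.2 hzy)) 2)
    have h1 := hP.sub_le_subsolutionDist hz hy hψc.upperSemicontinuousOn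
      (hψs.isSubsolution hP hψc.upperSemicontinuousOn)
    have h2 : ψ y = 0 := by
      rw [hψeq y hy hεlt.le]
      exact subsolutionDist_self hw hws
    have h3 : D z = subsolutionDist Ω H γ g z y := rfl
    linarith

/-- Near a compact set of points off the Aubry–Mather set there is one strict subsolution. -/
theorem exists_strict_subsolution_of_isCompact (hP : IsNeumannProblem Ω H γ g)
    (hw : UpperSemicontinuousOn w (closure Ω)) (hws : IsSubsolution Ω H γ g 0 w)
    {K : Set (EuclideanSpace ℝ (Fin n))} (hK : IsCompact K) (hKΩ : K ⊆ closure Ω)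
    (hKA : Disjoint K (aubryMatherSet Ω H γ g)) :
    ∃ U, IsOpen U ∧ K ⊆ U ∧ ∃ ψ : EuclideanSpace ℝ (Fin n) → ℝ, ContinuousOn ψ (closure Ω) ∧
      SubOn Ω H γ g univ 0 ψ ∧ ∃ δ > 0, SubOn Ω H γ g U (-δ) ψ := by
  refine hK.induction_on (p := fun K => ∃ U, IsOpen U ∧ K ⊆ U ∧
    ∃ ψ : EuclideanSpace ℝ (Fin n) → ℝ, ContinuousOn ψ (closure Ω) ∧
      SubOn Ω H γ g univ 0 ψ ∧ ∃ δ > 0, SubOn Ω H γ g U (-δ) ψ) ?_ ?_ ?_ ?_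
  · have := hws.subOn hP hw
    exact ⟨∅, isOpen_empty, subset_rfl, w, hP.continuousOn_of_subOn hw this, this, 1, one_pos,
      fun x _ hx => absurd hx (notMem_empty x)⟩
  · rintro s t hst ⟨U, hU, htU, h⟩
    exact ⟨U, hU, hst.trans htU, h⟩
  · rintro s t ⟨U₁, hU₁, hs, ψ₁, hψ₁, hψ₁s, δ₁, hδ₁, h₁⟩ ⟨U₂, hU₂, ht, ψ₂, hψ₂, hψ₂s, δ₂, hδ₂, h₂⟩
    have hcomb : ∀ {U : Set (EuclideanSpace ℝ (Fin n))} {s₁ s₂ : ℝ}, IsOpen U →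
        SubOn Ω H γ g U s₁ ψ₁ → SubOn Ω H γ g U s₂ ψ₂ →
        SubOn Ω H γ g U (1 / 2 * s₁ + 1 / 2 * s₂) (fun x => 1 / 2 * ψ₁ x + 1 / 2 * ψ₂ x) :=
      fun hU k₁ k₂ => hP.subOn_convexComb hU hψ₁.upperSemicontinuousOn hψ₁s
        hψ₂.upperSemicontinuousOn hψ₂s k₁ k₂ (by norm_num) (by norm_num) (by norm_num)
    -- On each set one average partner is strict and the other is still a subsolution, so half of
    -- the strictness survives.
    refine ⟨U₁ ∪ U₂, hU₁.union hU₂, union_subset_union hs ht,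
      fun x => 1 / 2 * ψ₁ x + 1 / 2 * ψ₂ x,
      (continuousOn_const.mul hψ₁).add (continuousOn_const.mul hψ₂),
      (hcomb isOpen_univ hψ₁s hψ₂s).mono subset_rfl (by norm_num),
      1 / 2 * min δ₁ δ₂, by positivity, fun x hx hxU => ?_⟩
    rcases hxU with hxU | hxU
    · refine (hcomb hU₁ h₁ (hψ₂s.mono (subset_univ _) le_rfl)).mono subset_rfl ?_ x hx hxU
      linarith [min_le_left δ₁ δ₂]
    · refine (hcomb hU₂ (hψ₁s.mono (subset_univ _) le_rfl) h₂).mono subset_rfl ?_ x hx hxU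
      linarith [min_le_right δ₁ δ₂]
  · intro y hyK
    obtain ⟨ψ, hψ, hψs, δ, hδ, r, hr, hstrict⟩ :=
      hP.exists_strict_subsolution (hKΩ hyK) hw hws (disjoint_left.1 hKA hyK)
    exact ⟨Metric.ball y r, mem_nhdsWithin_of_mem_nhds (Metric.ball_mem_nhds y hr),
      Metric.ball y r, Metric.isOpen_ball, subset_rfl, ψ, hψ, hψs, δ, hδ, hstrict⟩

/-- The comparison principle: it suffices to compare on the Aubry–Mather set. -/
theorem le_of_le_on_aubryMatherSet (hP : IsNeumannProblem Ω H γ g)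
    (hu : UpperSemicontinuousOn u (closure Ω)) (hus : IsSubsolution Ω H γ g 0 u)
    (hv : LowerSemicontinuousOn v (closure Ω)) (hvs : IsSupersolution Ω H γ g 0 v)
    (hA : ∀ x ∈ aubryMatherSet Ω H γ g, u x ≤ v x) (hx : x ∈ closure Ω) : u x ≤ v x := by
  by_contra hcon
  push Not at hcon
  have hS := hP.isCompact_closure
  have hu0 := hus.subOn hP hu
  have huc := hP.continuousOn_of_subOn hu hu0
  have husc : UpperSemicontinuousOn (fun x => u x + (-v) x) (closure Ω) := hu.add hv.neg
  obtain ⟨x₀, hx₀, hmax⟩ := husc.exists_isMaxOn ⟨x, hx⟩ hS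
  set M : ℝ := u x₀ + (-v) x₀ with hM
  have hMpos : 0 < M := by
    have : u x + -v x ≤ M := hmax hx
    linarith
  set K := closure Ω ∩ (fun x => u x + (-v) x) ⁻¹' Ici M with hK
  have hKc : IsCompact K := husc.isCompact_inter_preimage_Ici hS M
  have hKA : Disjoint K (aubryMatherSet Ω H γ g) := by
    rw [disjoint_left]
    intro y hyK hyA
    have h1 : M ≤ u y + -v y := hyK.2
    linarith [hA y hyA]
  obtain ⟨U, hU, hKU, ψ, hψ, hψs, δ, hδ, hstrict⟩ :=
    hP.exists_strict_subsolution_of_isCompact hu hus hKc inter_subset_left hKA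
  obtain ⟨B, hB⟩ := (hS.image_of_continuousOn (hψ.sub huc).norm).bddAbove
  have hB : ∀ a ∈ closure Ω, |ψ a - u a| ≤ B := fun a ha => hB ⟨a, ha, rfl⟩
  have hB0 : 0 ≤ B := (abs_nonneg _).trans (hB x hx)
  -- a gap off the neighbourhood `U` of the maximum points
  obtain ⟨τ, hτ, hgap⟩ : ∃ τ > 0, ∀ a ∈ closure Ω, a ∉ U → u a - v a ≤ M - τ := by
    have hcpt : IsCompact (closure Ω \ U) := hS.diff hU
    rcases (closure Ω \ U).eq_empty_or_nonempty with h0 | hne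
    · exact ⟨1, one_pos, fun a ha haU => absurd (h0 ▸ ⟨ha, haU⟩ : a ∈ (∅ : Set _)) (notMem_empty a)⟩
    · obtain ⟨b, hb, hbmax⟩ := (husc.mono sdiff_subset).exists_isMaxOn hne hcpt
      have hbM : u b + (-v) b < M := by
        by_contra h
        exact hb.2 (hKU ⟨hb.1, not_lt.1 h⟩)
      refine ⟨M - (u b + (-v) b), sub_pos.2 hbM, fun a ha haU => ?_⟩
      have : u a + -v a ≤ u b + (-v) b := hbmax ⟨ha, haU⟩
      linarith
  -- Replacing `u` by `f` changes values by at most `m * B`. Twice this is below the gap `τ`, which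
  -- keeps the maximum of `f - v` inside `U`.
  set m : ℝ := min (1 / 2) (τ / (4 * (B + 1))) with hm
  have hm0 : 0 < m := by positivity
  have hm1 : m ≤ 1 / 2 := min_le_left _ _
  have hmB : 2 * (m * B) < τ := by
    have h1 : m ≤ τ / (4 * (B + 1)) := min_le_right _ _
    rw [le_div_iff₀ (by positivity)] at h1
    nlinarith
  set f : EuclideanSpace ℝ (Fin n) → ℝ := fun a => (1 - m) * u a + m * ψ a with hf
  have hfu : ∀ a ∈ closure Ω, |f a - u a| ≤ m * B := by
    intro a ha
    have : f a - u a = m * (ψ a - u a) := by simp only [hf]; ring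
    rw [this, abs_mul, abs_of_pos hm0]
    exact mul_le_mul_of_nonneg_left (hB a ha) hm0.le
  have hfc : ContinuousOn f (closure Ω) :=
    (continuousOn_const.mul huc).add (continuousOn_const.mul hψ)
  obtain ⟨z, hz, hzmax⟩ :=
    (hfc.upperSemicontinuousOn.add hv.neg).exists_isMaxOn ⟨x, hx⟩ hS
  have hzU : z ∈ U := by
    by_contra hzU
    have h1 : f x₀ + -v x₀ ≤ f z + -v z := hzmax hx₀
    have h2 := hgap z hz hzU
    have h3 := (abs_le.1 (hfu x₀ hx₀)).1
    have h4 := (abs_le.1 (hfu z hz)).2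
    have h5 : M = u x₀ + -v x₀ := rfl
    linarith
  obtain ⟨r₁, hr₁, L, hL, hLip⟩ := hP.exists_common_lipschitz hz
  obtain ⟨r₂, hr₂, hrU⟩ := Metric.isOpen_iff.1 hU z hzU
  have hlocal : IsLocalMaxOn (fun a => (1 - m) * u a + m * ψ a - v a) (closure Ω) z := by
    filter_upwards [self_mem_nhdsWithin] with a ha
    have : f a + -v a ≤ f z + -v z := hzmax ha
    simp only [hf] at this
    linarith
  -- The levels are `0` for `u` and `-δ` for `ψ`, so their weighted level is `-m * δ`, strictly
  -- below the level `0` of `v`.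
  refine hP.not_isLocalMaxOn hz (lt_min hr₁ hr₂) hL
    (hLip u hu hu0 _ (min_le_left _ _)) (hLip ψ hψ.upperSemicontinuousOn hψs _ (min_le_left _ _))
    (hv.mono inter_subset_left) (hu0.mono (subset_univ _) le_rfl)
    (hstrict.mono ((Metric.ball_subset_ball (min_le_right _ _)).trans hrU) le_rfl)
    ((hvs.superOn hP hv).mono (subset_univ _) le_rfl)
    (by linarith) hm0 (by ring) ?_ hlocal
  nlinarith [mul_pos hm0 hδ]

end IsNeumannProblem

/-! ### The theorem. -/

theorem theorem6p5 {n : ℕ} (Ω : Set (EuclideanSpace ℝ (Fin n)))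
    (hΩo : IsOpen Ω) (hΩc : IsConnected Ω) (hΩb : Bornology.IsBounded Ω)
    (hΩ1 : HasC1Boundary Ω)
    (H : EuclideanSpace ℝ (Fin n) → EuclideanSpace ℝ (Fin n) → ℝ)
    (γ : EuclideanSpace ℝ (Fin n) → EuclideanSpace ℝ (Fin n))
    (g : EuclideanSpace ℝ (Fin n) → ℝ)
    (hH : ContinuousOn (fun q : EuclideanSpace ℝ (Fin n) × EuclideanSpace ℝ (Fin n) => H q.1 q.2)
      (closure Ω ×ˢ Set.univ))
    (hγ : ContinuousOn γ (frontier Ω))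
    (hg : ContinuousOn g (frontier Ω))
    (hconv : ∀ x ∈ closure Ω, ConvexOn ℝ Set.univ (H x))
    (hcoer : ∀ x ∈ closure Ω,
      Tendsto (H x) (Bornology.cobounded (EuclideanSpace ℝ (Fin n))) atTop)
    (hobl : ∀ x ∈ frontier Ω, ∀ ν : EuclideanSpace ℝ (Fin n),
      IsOuterUnitNormal Ω x ν → 0 < inner ℝ ν (γ x))
    (hcrit : criticalValue Ω H γ g = 0) :
    (∀ u v : EuclideanSpace ℝ (Fin n) → ℝ,
      UpperSemicontinuousOn u (closure Ω) → IsSubsolution Ω H γ g 0 u →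
      LowerSemicontinuousOn v (closure Ω) → IsSupersolution Ω H γ g 0 v →
      (∀ x ∈ aubryMatherSet Ω H γ g, u x ≤ v x) →
      ∀ x ∈ closure Ω, u x ≤ v x) ∧
    (∀ u v : EuclideanSpace ℝ (Fin n) → ℝ,
      ContinuousOn u (closure Ω) → IsViscositySolution Ω H γ g 0 u →
      ContinuousOn v (closure Ω) → IsViscositySolution Ω H γ g 0 v →
      (∀ x ∈ aubryMatherSet Ω H γ g, u x = v x) →
      ∀ x ∈ closure Ω, u x = v x) := by
  have hP : IsNeumannProblem Ω H γ g :=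
    ⟨hΩo, hΩc, hΩb, hΩ1, hH, hγ, hg, hconv, hcoer, hobl⟩
  refine ⟨fun u v hu hus hv hvs hA x hx => hP.le_of_le_on_aubryMatherSet hu hus hv hvs hA hx,
    fun u v hu hus hv hvs hA x hx => le_antisymm ?_ ?_⟩
  · exact hP.le_of_le_on_aubryMatherSet hu.upperSemicontinuousOn hus.1 hv.lowerSemicontinuousOn
      hvs.2 (fun x hx => (hA x hx).le) hx
  · exact hP.le_of_le_on_aubryMatherSet hv.upperSemicontinuousOn hvs.1 hu.lowerSemicontinuousOn
      hus.2 (fun x hx => (hA x hx).ge) hx
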